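/- Let $M>0$ and $\alpha>0$. Put $\mathcal D=\{(x,y)\in[0,1]^2: x\ge y\}$ and $$\|f\|_{\mathcal H_\alpha}=\max_{j+k\le\lfloor\alpha\rfloor}\ \sup_{(x,y)\in\mathcal D}|\nabla_{jk}f(x,y)|+\max_{j+k=\lfloor\alpha\rfloor}\ \sup_{(x,y)\ne(x',y')\in\mathcal D}\frac{|\nabla_{jk}f(x,y)-\nabla_{jk}f(x',y')|}{(|x-x'|+|y-y'|)^{\alpha-\lfloor\alpha\rfloor}},\qquad \nabla_{jk}=\frac{\partial^{j+k}}{(\partial x)^j(\partial y)^k},$$ and let $\mathcal F_\alpha(M)$ be the set of symmetric functions $f:[0,1]^2\to[0,1]$ that are $\lfloor\alpha\rfloor$ times differentiable on $\mathcal D$ and satisfy $\|f\|_{\mathcal H_\alpha}\le M$. For integers $1\le k\le n$ and reals $\lambda_1,\lambda_2,\delta$ with $0<\lambda_1\le 1\le\lambda_2$ and $0<\delta<1$, put $U_a=[\frac{a-1}{k},\frac ak)$ and let $\mathcal P$ be the set of probability distributions $\mathbb P_\xi$ on $[0,1]^n$ such that $$\mathbb P_\xi\Big(\frac{\lambda_1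 n}{k}\le\sum_{i=1}^n\mathbb I\{\xi_i\in U_a\}\le\frac{\lambda_2 n}{k}\ \text{ for all } a\in\{1,\dots,k\}\Big)>1-\exp(-n^\delta).$$ Given $f\in\mathcal F_\alpha(M)$ and $\mathbb P_\xi\in\mathcal P$, let $\xi=(\xi_1,\dots,\xi_n)\sim\mathbb P_\xi$, let $\theta_{ij}=f(\xi_i,\xi_j)$ for $i\ne j$ and $\theta_{ii}=0$, and, given $\xi$, let $A_{ij}=A_{ji}\sim\mathrm{Bernoulli}(\theta_{ij})$ be independent for $1\le j<i\le n$, with $A_{ii}=0$. An estimator $\hat\theta$ is any function of the adjacency matrix $A=(A_{ij})$ with values in $\mathbb R^{n\times n}$. Then there is a constant $C>0$ depending only on $M$ and $\alpha$ such that, for all $n\ge2$ and all $k,\lambda_1,\lambda_2,\delta$ as above for which $\mathcal P$ is non-empty, $$\inf_{\hat\theta}\sup_{f\in\mathcal F_\alpha(M)}\sup_{\mathbb P_\xi\in\mathcal P}\mathbb P\Big\{\frac1{n^2}\sum_{i,j=1}^n(\hat\theta_{ij}-\theta_{ij})^2\ge C\Big(n^{-\frac{2\alpha}{\alpha+1}}+\frac{\log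 n}{n}\Big)\Big\}\ge 0.8$$ and $$\inf_{\hat\theta}\sup_{f\in\mathcal F_\alpha(M)}\sup_{\mathbb P_\xi\in\mathcal P}\mathbb E\Big\{\frac1{n^2}\sum_{i,j=1}^n(\hat\theta_{ij}-\theta_{ij})^2\Big\}\ge C\Big(n^{-\frac{2\alpha}{\alpha+1}}+\frac{\log n}{n}\Big),$$ where the probability and the expectation are taken jointly over $A$ and $\xi$. -/

import Mathlib

open MeasureTheory Set
open scoped ENNReal unitInterval

namespace Graphon

noncomputable section

/-! ### The Hölder class of graphons -/

/-- The triangle `{(x, y) ∈ [0,1]² : y ≤ x}`. -/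
def triangle : Set (ℝ × ℝ) :=
  {p | p.1 ∈ Icc (0 : ℝ) 1 ∧ p.2 ∈ Icc (0 : ℝ) 1 ∧ p.2 ≤ p.1}

/-- `f` is `m` times differentiable on the (closed, convex, full-dimensional) triangle. Derivatives
at boundary points are taken within the triangle, where they are unique. -/
def TimesDifferentiable (m : ℕ) (f : ℝ × ℝ → ℝ) : Prop :=
  ∀ l < m, DifferentiableOn ℝ (iteratedFDerivWithin ℝ l f triangle) triangle

/-- The mixed partial derivative `∂^(j+k) f / (∂x)^j (∂y)^k` on the triangle. -/
def partialDeriv (j k : ℕ) (f : ℝ × ℝ → ℝ) (p : ℝ × ℝ) : ℝ :=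
  iteratedFDerivWithin ℝ (j + k) f triangle p
    (fun i => if (i : ℕ) < j then ((1 : ℝ), (0 : ℝ)) else ((0 : ℝ), (1 : ℝ)))

/-- The Hölder norm of smoothness `α`, as an extended nonnegative number. -/
def holderNorm (α : ℝ) (f : ℝ × ℝ → ℝ) : ℝ≥0∞ :=
  (⨆ (j : ℕ) (k : ℕ) (_ : j + k ≤ ⌊α⌋₊) (p ∈ triangle), ENNReal.ofReal |partialDeriv j k f p|) +
  ⨆ (j : ℕ) (k : ℕ) (_ : j + k = ⌊α⌋₊) (p ∈ triangle) (q ∈ triangle) (_ : p ≠ q),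
    ENNReal.ofReal (|partialDeriv j k f p - partialDeriv j k f q| /
      (|p.1 - q.1| + |p.2 - q.2|) ^ (α - (⌊α⌋₊ : ℝ)))

/-- The class of symmetric functions on `[0,1]²` with Hölder norm at most `M`
(values outside `[0,1]²` play no role). -/
def holderClass (α M : ℝ) : Set (ℝ × ℝ → ℝ) :=
  {f | TimesDifferentiable ⌊α⌋₊ f ∧ holderNorm α f ≤ ENNReal.ofReal M ∧
    ∀ x ∈ Icc (0 : ℝ) 1, ∀ y ∈ Icc (0 : ℝ) 1, f (x, y) = f (y, x)}

/-- The graphons with Hölder norm at most `M`. -/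
def graphonClass (α M : ℝ) : Set (ℝ × ℝ → ℝ) :=
  {f | f ∈ holderClass α M ∧
    ∀ x ∈ Icc (0 : ℝ) 1, ∀ y ∈ Icc (0 : ℝ) 1, 0 ≤ f (x, y) ∧ f (x, y) ≤ 1}

/-! ### The latent distributions -/

/-- The interval `U_a = [(a-1)/k, a/k)`. -/
def cell (k a : ℕ) : Set ℝ := Ico (((a : ℝ) - 1) / k) ((a : ℝ) / k)

/-- The number of latent points in a set. -/
def pointCount {n : ℕ} (ξ : Fin n → I) (U : Set ℝ) : ℕ := {i : Fin n | (ξ i : ℝ) ∈ U}.ncard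

/-- The event that each of the `k` intervals receives between `l₁ n / k` and `l₂ n / k` points. -/
def wellSpread (n k : ℕ) (l₁ l₂ : ℝ) : Set (Fin n → I) :=
  {ξ | ∀ a ∈ Icc 1 k, l₁ * n / k ≤ (pointCount ξ (cell k a) : ℝ) ∧
    (pointCount ξ (cell k a) : ℝ) ≤ l₂ * n / k}

/-- The class of distributions of the latent vector `(ξ_1, …, ξ_n)`. -/
def latentClass (n k : ℕ) (l₁ l₂ δ : ℝ) : Set (Measure (Fin n → I)) :=
  {μ | IsProbabilityMeasure μ ∧
    1 - Real.exp (-((n : ℝ) ^ δ)) < μ.real (wellSpread n k l₁ l₂)}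

/-! ### The random graph -/

/-- Adjacency matrices, with `true` for `1` and `false` for `0`. -/
abbrev Adjacency (n : ℕ) : Type := Fin n → Fin n → Bool

/-- The pairs `(i, j)` with `j < i`. -/
abbrev Pair (n : ℕ) : Type := {e : Fin n × Fin n // e.2 < e.1}

/-- The symmetric matrix with zero diagonal and the given entries below the diagonal. -/
def symmetrize {n : ℕ} (x : Pair n → Bool) : Adjacency n := fun i j =>
  if h : j < i then x ⟨(i, j), h⟩ else if h : i < j then x ⟨(j, i), h⟩ else false

/-- The Bernoulli distribution on `{true, false}` with mean `p ∈ [0,1]` (arguments outside `[0,1]`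
do not occur; there `p` is replaced by the nearest point of `[0,1]`). -/
def bernoulliLaw (p : ℝ) : Measure Bool :=
  ProbabilityTheory.bernoulliMeasure true false (projIcc 0 1 zero_le_one p)

/-- The law of the adjacency matrix `A` when `A i j = A j i`, `j < i`, are independent
Bernoulli variables with means `θ i j`, and `A i i = 0`. -/
def adjacencyLaw {n : ℕ} (θ : Matrix (Fin n) (Fin n) ℝ) : Measure (Adjacency n) :=
  (Measure.pi fun e : Pair n => bernoulliLaw (θ e.1.1 e.1.2)).map symmetrize

/-- `θ i j = f (ξ i, ξ j)` for `i ≠ j`, and `θ i i = 0`. -/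
def edgeProb {n : ℕ} (f : ℝ × ℝ → ℝ) (ξ : Fin n → I) : Matrix (Fin n) (Fin n) ℝ :=
  Matrix.of fun i j => if i = j then 0 else f ((ξ i : ℝ), (ξ j : ℝ))

/-- The joint law of `(ξ, A)`: `ξ` has law `μ` and, given `ξ`, `A` has law
`adjacencyLaw (edgeProb f ξ)`. -/
def jointLaw {n : ℕ} (f : ℝ × ℝ → ℝ) (μ : Measure (Fin n → I)) :
    Measure ((Fin n → I) × Adjacency n) :=
  μ.bind fun ξ => (Measure.dirac ξ).prod (adjacencyLaw (edgeProb f ξ))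

/-- Estimators of the matrix `θ`: functions of the observed adjacency matrix. There are finitely
many adjacency matrices, so measurability is automatic. -/
abbrev Estimator (n : ℕ) : Type := Adjacency n → Matrix (Fin n) (Fin n) ℝ

/-- The loss `n⁻² ∑ (T i j - θ i j)²`. -/
def loss {n : ℕ} (T θ : Matrix (Fin n) (Fin n) ℝ) : ℝ :=
  1 / (n : ℝ) ^ 2 * ∑ i, ∑ j, (T i j - θ i j) ^ 2

/-- The rate `n^(-2α/(α+1)) + log n / n`. -/
def rate (α : ℝ) (n : ℕ) : ℝ :=
  (n : ℝ) ^ (-(2 * α / (α + 1))) + Real.log n / n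

end

end Graphon

/-! A point mass at an admissible latent vector is an admissible law, so it is enough to exhibit,
for each `n`, a finite family of graphons and deterministic positions on which every estimator fails
somewhere. All edge probabilities of the family stay within `d` of a constant `q`. The homogeneous
graph with edge probability `q` then serves as a reference law: each member has second moment at
most `χ = exp (n² d² / (q (1 - q)))` relative to it. If moreover, for every matrix `T`, at most a
proportion `ρ` of the members lie within loss `r` of `T`, the average success probability of an
estimator is at most `√(χ ρ)`. With `χ ρ ≤ 1 / 25` some member has loss at least `r` with
probability at least `4 / 5` (`exists_unlikely`, `minimax_lower_bound`), and Markov's inequality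
gives the bound in expectation.

Positions come from a grid with equally many points in each cell. Non-emptiness of the latent class
is what makes it admissible: by pigeonhole `λ₁ n / k` cannot exceed the integer part of `n / k`
(`exists_gridDesign_mem_wellSpread`).

The two terms of the rate need different families, but up to constants only one term matters for a
given `α`.

For `α < 1` the power of `n` dominates. The graphon carries a `K × K` array of tents of height `d`
and unknown signs. The Hölder norm allows `d ≍ K^(-α)` and the information budget allows `n d ≍ K`,
whence `K ≍ n^(1/(1+α))` and `d² ≍ n^(-2α/(α+1))`. An exponential moment over the hypercube shows
that a proportion at most `(3/4)^(K²)` of the sign patterns is close to a given `T`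
(`card_hypercube_lt_le`).

For `α ≥ 1` the term `log n / n` dominates. The graphon `q + d cos (2π m x y)` is fixed and the
positions of the upper half of the grid nodes are permuted. A node at position `x` has a cosine of
frequency proportional to `x` as its row; cosines of separated frequencies are nearly orthogonal, so
a given row of `T` fits only about a fraction `1 / m` of the positions. A permanent bound turns this
into a proportion `(C / √m)^L` of the permutations of `L` nodes (`card_perm_lt_le`), which beats `χ`
as soon as `n d²` is a small multiple of `log m`. A small power `m = n^ε` keeps the Hölder norm
bounded.

Boundedly many nodes are handled by constant graphons. -/

namespace Graphon

/-! ### Likelihoods of the graph and the second-moment reduction. -/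

/-- The probability that a Bernoulli variable of mean `p` takes the value `b`. -/
noncomputable def bernoulliWeight (p : ℝ) (b : Bool) : ℝ := if b then p else 1 - p

/-- The probability of a configuration of edges under independent Bernoulli variables. -/
noncomputable def edgeWeight {n : ℕ} (θ : Matrix (Fin n) (Fin n) ℝ) (x : Pair n → Bool) : ℝ :=
  ∏ e, bernoulliWeight (θ e.1.1 e.1.2) (x e)

lemma bernoulliLaw_singleton {p : ℝ} (h0 : 0 ≤ p) (h1 : p ≤ 1) (b : Bool) :
    bernoulliLaw p {b} = ENNReal.ofReal (bernoulliWeight p b) := by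
  have hp : projIcc (0 : ℝ) 1 zero_le_one p = ⟨p, h0, h1⟩ := projIcc_of_mem _ ⟨h0, h1⟩
  have : IsProbabilityMeasure (bernoulliLaw p) := by unfold bernoulliLaw; infer_instance
  have h := ENNReal.ofReal_toReal (measure_ne_top (bernoulliLaw p) {b})
  rw [← h]
  congr 1
  change (bernoulliLaw p).real {b} = _
  unfold bernoulliLaw
  rw [hp, ProbabilityTheory.bernoulliMeasure_real_apply _ (by simp)]
  cases b <;> simp [bernoulliWeight]

instance (p : ℝ) : IsProbabilityMeasure (bernoulliLaw p) := by unfold bernoulliLaw; infer_instance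

instance {n : ℕ} (θ : Matrix (Fin n) (Fin n) ℝ) : IsProbabilityMeasure (adjacencyLaw θ) := by
  unfold adjacencyLaw
  exact Measure.isProbabilityMeasure_map (measurable_of_finite _).aemeasurable

lemma bernoulliWeight_nonneg {p : ℝ} (h0 : 0 ≤ p) (h1 : p ≤ 1) (b : Bool) :
    0 ≤ bernoulliWeight p b := by
  cases b <;> simp [bernoulliWeight] <;> linarith

lemma bernoulliWeight_pos {p : ℝ} (h0 : 0 < p) (h1 : p < 1) (b : Bool) :
    0 < bernoulliWeight p b := by
  cases b <;> simp [bernoulliWeight] <;> linarith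

open Classical in
lemma adjacencyLaw_real {n : ℕ} {θ : Matrix (Fin n) (Fin n) ℝ} (h0 : ∀ i j, 0 ≤ θ i j)
    (h1 : ∀ i j, θ i j ≤ 1) (S : Set (Adjacency n)) :
    (adjacencyLaw θ).real S = ∑ x, if symmetrize x ∈ S then edgeWeight θ x else 0 := by
  have hm : Measurable (symmetrize (n := n)) := measurable_of_finite _
  have hpi : ∀ x : Pair n → Bool, (Measure.pi fun e : Pair n => bernoulliLaw (θ e.1.1 e.1.2)).real {x}
      = edgeWeight θ x := by
    intro x
    rw [measureReal_def, Measure.pi_singleton, ENNReal.toReal_prod]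
    refine Finset.prod_congr rfl fun e _ => ?_
    rw [bernoulliLaw_singleton (h0 _ _) (h1 _ _), ENNReal.toReal_ofReal]
    exact bernoulliWeight_nonneg (h0 _ _) (h1 _ _) _
  unfold adjacencyLaw
  rw [map_measureReal_apply hm (Set.toFinite S).measurableSet, ← Finset.sum_filter]
  have : symmetrize ⁻¹' S = ((Finset.univ.filter fun x : Pair n → Bool => symmetrize x ∈ S) :
      Set (Pair n → Bool)) := by
    ext x; simp
  rw [this, ← sum_measureReal_singleton]
  exact Finset.sum_congr rfl fun x _ => hpi x

lemma sum_prod_bool {E : Type*} [Fintype E] [DecidableEq E] (g : E → Bool → ℝ) :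
    ∑ x : E → Bool, ∏ e, g e (x e) = ∏ e, (g e true + g e false) := by
  have := Finset.prod_univ_sum (fun _ : E => (Finset.univ : Finset Bool)) g
  rw [Fintype.piFinset_univ] at this
  rw [← this]
  exact Finset.prod_congr rfl fun e _ => Fintype.sum_bool _

lemma sum_prod_bernoulliWeight {E : Type*} [Fintype E] [DecidableEq E] (q : ℝ) :
    ∑ x : E → Bool, ∏ e, bernoulliWeight q (x e) = 1 := by
  rw [sum_prod_bool]; simp [bernoulliWeight]

/-- The sum factorises over the edges. An edge of probability `t` contributes exactly `1 + (t - q)²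
/ (q (1 - q))`, which is at most an exponential, and there are at most `n²` edges. -/
lemma secondMoment_le {n : ℕ} {θ : Matrix (Fin n) (Fin n) ℝ} {q d : ℝ} (hq0 : 0 < q) (hq1 : q < 1)
    (hd : ∀ i j, i ≠ j → |θ i j - q| ≤ d) :
    ∑ x, edgeWeight θ x ^ 2 / ∏ e, bernoulliWeight q (x e)
      ≤ Real.exp ((n : ℝ) ^ 2 * d ^ 2 / (q * (1 - q))) := by
  have hqq : 0 < q * (1 - q) := mul_pos hq0 (by linarith)
  have h1 : ∀ x : Pair n → Bool, edgeWeight θ x ^ 2 / ∏ e, bernoulliWeight q (x e)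
      = ∏ e, (bernoulliWeight (θ e.1.1 e.1.2) (x e) ^ 2 / bernoulliWeight q (x e)) := by
    intro x
    rw [Finset.prod_div_distrib, Finset.prod_pow, edgeWeight]
  simp_rw [h1]
  rw [sum_prod_bool fun (e : Pair n) b =>
    bernoulliWeight (θ e.1.1 e.1.2) b ^ 2 / bernoulliWeight q b]
  have h2 : ∀ e : Pair n, bernoulliWeight (θ e.1.1 e.1.2) true ^ 2 / bernoulliWeight q true +
      bernoulliWeight (θ e.1.1 e.1.2) false ^ 2 / bernoulliWeight q false
      ≤ Real.exp (d ^ 2 / (q * (1 - q))) := by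
    intro e
    set t := θ e.1.1 e.1.2
    have ht : (t - q) ^ 2 ≤ d ^ 2 := sq_le_sq' (by
      have := (abs_le.1 (hd e.1.1 e.1.2 (ne_of_gt e.2))).1; linarith)
      (abs_le.1 (hd e.1.1 e.1.2 (ne_of_gt e.2))).2
    have : bernoulliWeight t true ^ 2 / bernoulliWeight q true +
      bernoulliWeight t false ^ 2 / bernoulliWeight q false = (t - q) ^ 2 / (q * (1 - q)) + 1 := by
      have : 1 - q ≠ 0 := by linarith
      simp only [bernoulliWeight]
      simp
      field_simp
      ring
    rw [this]
    refine le_trans ?_ (Real.add_one_le_exp _)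
    gcongr
  have hn : (Fintype.card (Pair n) : ℝ) ≤ (n : ℝ) ^ 2 := by
    have : Fintype.card (Pair n) ≤ Fintype.card (Fin n × Fin n) := Fintype.card_subtype_le _
    rw [Fintype.card_prod, Fintype.card_fin] at this
    rw [pow_two]; exact_mod_cast this
  calc _ ≤ ∏ e : Pair n, Real.exp (d ^ 2 / (q * (1 - q))) := by
        refine Finset.prod_le_prod (fun e _ => ?_) fun e _ => h2 e
        have a := (bernoulliWeight_pos hq0 hq1 true).le
        have b := (bernoulliWeight_pos hq0 hq1 false).le
        positivity
    _ = Real.exp (Fintype.card (Pair n) * (d ^ 2 / (q * (1 - q)))) := by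
        rw [Finset.prod_const, ← Real.exp_nat_mul, Finset.card_univ]
    _ ≤ _ := by
        rw [mul_div_assoc]
        gcongr

open Classical in
/-- If the second moments of a finite family of densities are at most `χ` and each point lies in at
most a proportion `ρ` of the events `E v`, where `χ ρ ≤ 1 / 25`, then some event is unlikely. -/
lemma exists_unlikely {V X : Type*} [Fintype V] [Nonempty V] [Fintype X] (w : V → X → ℝ)
    (Q : X → ℝ) (hQ : ∀ x, 0 < Q x) (hQ1 : ∑ x, Q x = 1) {χ ρ : ℝ} (hχ0 : 0 < χ)
    (hχ : ∀ v, ∑ x, w v x ^ 2 / Q x ≤ χ) (E : V → Set X)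
    (hE : ∀ x, ((Finset.univ.filter fun v => x ∈ E v).card : ℝ) ≤ ρ * Fintype.card V)
    (hρ : χ * ρ ≤ 1 / 25) :
    ∃ v, (∑ x, if x ∈ E v then w v x else 0) ≤ 1 / 5 := by
  by_contra! hcon
  -- Weight in the AM-GM inequality `w ≤ (t w² / Q + Q / t) / 2`. On average over `v` it gives `(t χ
  -- + ρ / t) / 2 = (1 / 5 + 5 χ ρ) / 2 ≤ 1 / 5`.
  set t : ℝ := 1 / (5 * χ) with ht
  have ht0 : 0 < t := by positivity
  have hpt : ∀ v x, (if x ∈ E v then w v x else 0) ≤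
      (t * (w v x ^ 2 / Q x) + (if x ∈ E v then Q x else 0) / t) / 2 := by
    intro v x
    have hq := hQ x
    split_ifs
    · have : t * (w v x ^ 2 / Q x) + Q x / t - 2 * w v x = (t * w v x - Q x) ^ 2 / (t * Q x) := by
        field_simp; ring
      have h2 : 0 ≤ (t * w v x - Q x) ^ 2 / (t * Q x) := by positivity
      linarith
    · have : 0 ≤ t * (w v x ^ 2 / Q x) := by positivity
      simp; linarith
  have hsum : ∑ v, ∑ x, (if x ∈ E v then Q x else 0) ≤ ρ * Fintype.card V := by
    rw [Finset.sum_comm]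
    calc _ = ∑ x, Q x * (Finset.univ.filter fun v => x ∈ E v).card := by
          refine Finset.sum_congr rfl fun x _ => ?_
          rw [← Finset.sum_filter, Finset.sum_const, nsmul_eq_mul, mul_comm]
      _ ≤ ∑ x, Q x * (ρ * Fintype.card V) :=
          Finset.sum_le_sum fun x _ => mul_le_mul_of_nonneg_left (hE x) (hQ x).le
      _ = _ := by rw [← Finset.sum_mul, hQ1, one_mul]
  have hV : (0 : ℝ) < Fintype.card V := by exact_mod_cast Fintype.card_pos
  have h1 : (Fintype.card V : ℝ) * (1 / 5) < ∑ v, ∑ x, if x ∈ E v then w v x else 0 := by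
    have := Finset.sum_lt_sum_of_nonempty (s := (Finset.univ : Finset V)) Finset.univ_nonempty
      fun v _ => hcon v
    simpa using this
  have h2 : ∑ v, ∑ x, (if x ∈ E v then w v x else 0) ≤
      (t * (Fintype.card V * χ) + ρ * Fintype.card V / t) / 2 := by
    calc _ ≤ ∑ v, ∑ x, (t * (w v x ^ 2 / Q x) + (if x ∈ E v then Q x else 0) / t) / 2 :=
          Finset.sum_le_sum fun v _ => Finset.sum_le_sum fun x _ => hpt v x
      _ = (t * ∑ v, ∑ x, w v x ^ 2 / Q x + (∑ v, ∑ x, (if x ∈ E v then Q x else 0)) / t) / 2 := by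
          simp_rw [← Finset.sum_div, Finset.sum_add_distrib, Finset.mul_sum, ← Finset.sum_div]
      _ ≤ _ := by
          gcongr
          calc _ ≤ ∑ v : V, χ := Finset.sum_le_sum fun v _ => hχ v
            _ = _ := by simp
  have h3 : t * (Fintype.card V * χ) = Fintype.card V / 5 := by rw [ht]; field_simp
  have h4 : ρ * Fintype.card V / t = 5 * Fintype.card V * (χ * ρ) := by rw [ht]; field_simp
  rw [h3, h4] at h2
  nlinarith

/-- Under a point mass the kernel agrees almost everywhere with a constant one, so the mixture is
computed without any measurability in the latent vector. -/
lemma jointLaw_dirac {n : ℕ} (f : ℝ × ℝ → ℝ) (ξ : Fin n → I) :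
    jointLaw f (Measure.dirac ξ) = (adjacencyLaw (edgeProb f ξ)).map (Prod.mk ξ) := by
  unfold jointLaw
  set κ : (Fin n → I) → Measure ((Fin n → I) × Adjacency n) :=
    fun ξ => (Measure.dirac ξ).prod (adjacencyLaw (edgeProb f ξ)) with hκ
  have h : κ =ᵐ[Measure.dirac ξ] fun _ => κ ξ := by
    rw [Filter.EventuallyEq, ae_dirac_eq]; simp
  rw [Measure.bind_congr_right h, Measure.bind_const]
  simp [hκ, Measure.dirac_prod]

lemma jointLaw_dirac_apply {n : ℕ} (f : ℝ × ℝ → ℝ) (ξ : Fin n → I)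
    (S : Set ((Fin n → I) × Adjacency n)) :
    jointLaw f (Measure.dirac ξ) S = adjacencyLaw (edgeProb f ξ) {a | (ξ, a) ∈ S} := by
  rw [jointLaw_dirac, (measurableEmbedding_prodMk_left ξ).map_apply]; rfl

lemma lintegral_jointLaw_dirac {n : ℕ} (f : ℝ × ℝ → ℝ) (ξ : Fin n → I)
    (g : (Fin n → I) × Adjacency n → ℝ≥0∞) :
    ∫⁻ ω, g ω ∂(jointLaw f (Measure.dirac ξ)) = ∫⁻ a, g (ξ, a) ∂(adjacencyLaw (edgeProb f ξ)) := by
  rw [jointLaw_dirac, (measurableEmbedding_prodMk_left ξ).lintegral_map]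

lemma dirac_mem_latentClass {n k : ℕ} {l₁ l₂ : ℝ} (δ : ℝ) {ξ : Fin n → I}
    (h : ξ ∈ wellSpread n k l₁ l₂) : Measure.dirac ξ ∈ latentClass n k l₁ l₂ δ := by
  refine ⟨inferInstance, ?_⟩
  rw [measureReal_def, Measure.dirac_apply]
  simp [h, Real.exp_pos]

open Classical in
/-- A lower bound on the minimax risk from a finite family of graphons and latent positions whose
edge probabilities are close to a constant `q`. -/
lemma minimax_lower_bound {α M : ℝ} {n k : ℕ} {l₁ l₂ δ : ℝ} {V : Type*} [Fintype V] [Nonempty V]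
    (f : V → ℝ × ℝ → ℝ) (ξ : V → Fin n → I) (hf : ∀ v, f v ∈ graphonClass α M)
    (hξ : ∀ v, ξ v ∈ wellSpread n k l₁ l₂) {q d r ρ : ℝ} (hq0 : 0 < q) (hq1 : q < 1) (hr : 0 ≤ r)
    (hd : ∀ v, ∀ i j, i ≠ j → |f v (ξ v i, ξ v j) - q| ≤ d)
    (hρ : ∀ T : Matrix (Fin n) (Fin n) ℝ,
      ((Finset.univ.filter fun v => loss T (edgeProb (f v) (ξ v)) < r).card : ℝ)
        ≤ ρ * Fintype.card V)
    (hχ : Real.exp ((n : ℝ) ^ 2 * d ^ 2 / (q * (1 - q))) * ρ ≤ 1 / 25) :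
    (ENNReal.ofReal 0.8 ≤ ⨅ T : Estimator n, ⨆ f ∈ graphonClass α M,
      ⨆ μ ∈ latentClass n k l₁ l₂ δ,
        jointLaw f μ {ω | r ≤ loss (T ω.2) (edgeProb f ω.1)}) ∧
    (ENNReal.ofReal (0.8 * r) ≤ ⨅ T : Estimator n, ⨆ f ∈ graphonClass α M,
      ⨆ μ ∈ latentClass n k l₁ l₂ δ,
        ∫⁻ ω, ENNReal.ofReal (loss (T ω.2) (edgeProb f ω.1)) ∂(jointLaw f μ)) := by
  have key : ∀ T : Estimator n, ∃ v, ENNReal.ofReal 0.8 ≤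
      adjacencyLaw (edgeProb (f v) (ξ v)) {a | r ≤ loss (T a) (edgeProb (f v) (ξ v))} := by
    intro T
    obtain ⟨v, hv⟩ := exists_unlikely (fun v => edgeWeight (edgeProb (f v) (ξ v)))
      (fun x => ∏ e, bernoulliWeight q (x e))
      (fun x => Finset.prod_pos fun e _ => bernoulliWeight_pos hq0 hq1 _)
      (sum_prod_bernoulliWeight q) (Real.exp_pos _)
      (fun v => secondMoment_le hq0 hq1 (d := d) (fun i j hij => by
        simpa [edgeProb, hij] using hd v i j hij))
      (fun v => {x | loss (T (symmetrize x)) (edgeProb (f v) (ξ v)) < r})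
      (fun x => hρ (T (symmetrize x))) hχ
    refine ⟨v, ?_⟩
    set θ := edgeProb (f v) (ξ v) with hθ
    have hθ' : ∀ i j, 0 ≤ θ i j ∧ θ i j ≤ 1 := by
      intro i j
      by_cases hij : i = j
      · simp [hθ, edgeProb, hij]
      · simpa [hθ, edgeProb, hij] using (hf v).2 _ (ξ v i).2 _ (ξ v j).2
    have h1 := adjacencyLaw_real (fun i j => (hθ' i j).1) (fun i j => (hθ' i j).2)
      {a | loss (T a) θ < r}
    have h2 : (adjacencyLaw θ).real {a | loss (T a) θ < r} ≤ 1 / 5 := by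
      rw [h1]; exact hv
    have h3 : {a | r ≤ loss (T a) θ} = {a | loss (T a) θ < r}ᶜ := by ext; simp
    rw [h3, ENNReal.ofReal_le_iff_le_toReal (measure_ne_top _ _)]
    change _ ≤ (adjacencyLaw θ).real _
    rw [probReal_compl_eq_one_sub (Set.toFinite _).measurableSet]
    norm_num at h2 ⊢
    linarith
  constructor
  · refine le_iInf fun T => ?_
    obtain ⟨v, hv⟩ := key T
    refine le_iSup₂_of_le (f v) (hf v) (le_iSup₂_of_le _ (dirac_mem_latentClass δ (hξ v)) ?_)
    rw [jointLaw_dirac_apply]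
    exact hv
  · refine le_iInf fun T => ?_
    obtain ⟨v, hv⟩ := key T
    refine le_iSup₂_of_le (f v) (hf v) (le_iSup₂_of_le _ (dirac_mem_latentClass δ (hξ v)) ?_)
    -- Markov's inequality: the expected loss is at least `r` times the probability of the event in
    -- `hv`.
    rw [lintegral_jointLaw_dirac, mul_comm, ENNReal.ofReal_mul hr]
    refine le_trans (mul_le_mul_right hv _) (le_trans (mul_le_mul_right (measure_mono ?_) _)
      (mul_meas_ge_le_lintegral (measurable_of_finite _) (ENNReal.ofReal r)))
    intro a ha
    exact ENNReal.ofReal_le_ofReal ha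


/-! ### Admissible deterministic positions. -/

/-- The equispaced grid `0, 1 / N, …, (N - 1) / N`, continued by `1`. -/
noncomputable def gridPoint (N t : ℕ) : ℝ := if t < N then (t : ℝ) / N else 1

lemma gridPoint_mem (N t : ℕ) : gridPoint N t ∈ I := by
  unfold gridPoint
  split_ifs with h
  · have : (t : ℝ) ≤ N := by exact_mod_cast h.le
    exact ⟨by positivity, div_le_one_of_le₀ this (by positivity)⟩
  · simp

/-- Latent positions: the grid, permuted by `τ`. -/
noncomputable def gridDesign {n : ℕ} (N : ℕ) (τ : Equiv.Perm (Fin n)) (i : Fin n) : I :=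
  ⟨gridPoint N (τ i), gridPoint_mem N _⟩

/-- Each cell receives a block of `q` consecutive grid points. The surplus points sit at `1`, which
belongs to no cell because the cells are open on the right. -/
lemma gridPoint_mem_cell {k q a : ℕ} (hk : 1 ≤ k) (hq : 1 ≤ q) (ha : 1 ≤ a) (hak : a ≤ k) (t : ℕ) :
    gridPoint (k * q) t ∈ cell k a ↔ (a - 1) * q ≤ t ∧ t < a * q := by
  have hk' : (0 : ℝ) < k := by exact_mod_cast hk
  have hq' : (0 : ℝ) < q := by exact_mod_cast hq
  unfold gridPoint cell
  split_ifs with h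
  · obtain ⟨b, rfl⟩ : ∃ b, a = b + 1 := ⟨a - 1, by omega⟩
    have e1 : ((b + 1 : ℕ) - 1 : ℝ) / k ≤ (t : ℝ) / (k * q : ℕ) ↔ b * q ≤ t := by
      rw [← Nat.cast_le (α := ℝ)]
      push_cast
      rw [div_le_div_iff₀ hk' (by positivity)]
      constructor
      · intro h; nlinarith
      · intro h; nlinarith
    have e2 : (t : ℝ) / (k * q : ℕ) < ((b + 1 : ℕ) : ℝ) / k ↔ t < (b + 1) * q := by
      rw [← Nat.cast_lt (α := ℝ)]
      push_cast
      rw [div_lt_div_iff₀ (by positivity) hk']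
      constructor
      · intro h; nlinarith
      · intro h; nlinarith
    rw [mem_Ico, e1, e2]; simp
  · constructor
    · intro h'
      have := h'.2
      rw [lt_div_iff₀ hk'] at this
      have : k < a := by exact_mod_cast (by linarith : (k : ℝ) < a)
      omega
    · intro h'
      have : a * q ≤ k * q := Nat.mul_le_mul_right _ hak
      omega

lemma pointCount_gridDesign {n k q a : ℕ} (hk : 1 ≤ k) (hq : 1 ≤ q) (hn : k * q ≤ n)
    (ha : 1 ≤ a) (hak : a ≤ k) (τ : Equiv.Perm (Fin n)) :
    pointCount (gridDesign (k * q) τ) (cell k a) = q := by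
  unfold pointCount gridDesign
  simp only [gridPoint_mem_cell hk hq ha hak]
  have haq : a * q ≤ n := (Nat.mul_le_mul_right _ hak).trans hn
  have h1 : {i : Fin n | (a - 1) * q ≤ (τ i : ℕ) ∧ (τ i : ℕ) < a * q} =
      τ ⁻¹' (Fin.val ⁻¹' ((Finset.Ico ((a - 1) * q) (a * q) : Finset ℕ) : Set ℕ)) := by
    ext i; simp
  rw [h1, Set.ncard_preimage_of_injective_subset_range τ.injective (by simp [τ.surjective.range_eq]),
    Set.ncard_preimage_of_injective_subset_range Fin.val_injective, Set.ncard_coe_finset,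
    Nat.card_Ico]
  · obtain ⟨b, rfl⟩ : ∃ b, a = b + 1 := ⟨a - 1, by omega⟩
    simp [Nat.add_mul]
  · intro x hx
    simp only [Finset.coe_Ico, mem_Ico] at hx
    exact ⟨⟨x, by omega⟩, rfl⟩

lemma sum_pointCount_le {n k : ℕ} (ξ : Fin n → I) :
    ∑ a ∈ Finset.Icc 1 k, pointCount ξ (cell k a) ≤ n := by
  classical
  have h : ∀ a, pointCount ξ (cell k a) =
      (Finset.univ.filter fun i : Fin n => (ξ i : ℝ) ∈ cell k a).card := by
    intro a
    unfold pointCount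
    rw [← Set.ncard_coe_finset]; simp
  simp_rw [h]
  rw [← Finset.card_biUnion]
  · exact (Finset.card_le_univ _).trans (by simp)
  · intro a ha b hb hab
    have hk : (0 : ℝ) < k := by
      simp only [Finset.coe_Icc, mem_Icc] at ha
      exact_mod_cast (by omega : 0 < k)
    refine Finset.disjoint_left.2 ?_
    intro i hi hi'
    simp only [Finset.mem_filter, Finset.mem_univ, true_and, cell, mem_Ico, div_le_iff₀ hk,
      lt_div_iff₀ hk] at hi hi'
    apply hab
    have h1 : a < b + 1 := by exact_mod_cast (by linarith : (a : ℝ) < b + 1)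
    have h2 : b < a + 1 := by exact_mod_cast (by linarith : (b : ℝ) < a + 1)
    omega

/-- If some distribution is admissible, then so are all permutations of a fine enough grid. -/
lemma exists_gridDesign_mem_wellSpread {n k : ℕ} {l₁ l₂ δ : ℝ} (hk : 1 ≤ k) (hkn : k ≤ n)
    (hl₂ : 1 ≤ l₂) (h : (latentClass n k l₁ l₂ δ).Nonempty) :
    ∃ N : ℕ, N ≤ n ∧ n < 2 * N ∧
      ∀ τ : Equiv.Perm (Fin n), gridDesign N τ ∈ wellSpread n k l₁ l₂ := by
  obtain ⟨μ, hμ, hμ'⟩ := h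
  have hne : (wellSpread n k l₁ l₂).Nonempty := by
    rw [Set.nonempty_iff_ne_empty]
    intro he
    rw [he] at hμ'
    have : 0 ≤ (n : ℝ) ^ δ := by positivity
    simp at hμ'
    linarith
  obtain ⟨ξ, hξ⟩ := hne
  have hk' : (0 : ℝ) < k := by exact_mod_cast hk
  set q := n / k with hq
  have hq1 : 1 ≤ q := (Nat.one_le_div_iff hk).2 hkn
  have hkq : k * q ≤ n := Nat.mul_div_le n k
  have hlt : n < k * q + k := by
    have := Nat.lt_mul_div_succ n hk
    rw [mul_add, mul_one] at this
    exact this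
  -- Otherwise every cell would hold at least `q + 1` points of `ξ`, and `k (q + 1) > n`.
  have hlow : l₁ * n / k ≤ q := by
    by_contra! hcon
    have hge : ∀ a ∈ Finset.Icc 1 k, q + 1 ≤ pointCount ξ (cell k a) := by
      intro a ha
      have h1 := (hξ a (by simpa using ha)).1
      have : (q : ℝ) < pointCount ξ (cell k a) := lt_of_lt_of_le hcon h1
      exact_mod_cast this
    have := (Finset.card_nsmul_le_sum _ _ _ hge).trans (sum_pointCount_le ξ)
    simp only [Nat.card_Icc, smul_eq_mul, Nat.add_sub_cancel] at this
    rw [mul_add, mul_one] at this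
    omega
  have hup : (q : ℝ) ≤ l₂ * n / k := by
    rw [le_div_iff₀ hk']
    have h1 : (q : ℝ) * k ≤ n := by rw [mul_comm]; exact_mod_cast hkq
    have h2 : (n : ℝ) ≤ l₂ * n := le_mul_of_one_le_left (by positivity) hl₂
    linarith
  refine ⟨k * q, hkq, ?_, fun τ a ha => ?_⟩
  · have : k * 1 ≤ k * q := Nat.mul_le_mul_left _ hq1
    omega
  · rw [pointCount_gridDesign hk hq1 hkq ha.1 ha.2]
    exact ⟨hlow, hup⟩


/-! ### Hölder norms of smooth functions and the cosine graphon. -/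

lemma convex_triangle : Convex ℝ triangle := by
  intro p hp q hq a b ha hb hab
  obtain ⟨⟨h1, h2⟩, ⟨h3, h4⟩, h5⟩ := hp
  obtain ⟨⟨g1, g2⟩, ⟨g3, g4⟩, g5⟩ := hq
  refine ⟨⟨?_, ?_⟩, ⟨?_, ?_⟩, ?_⟩ <;> simp only [Prod.fst_add, Prod.snd_add, Prod.smul_fst,
    Prod.smul_snd, smul_eq_mul] <;> nlinarith

lemma interior_triangle_nonempty : (interior triangle).Nonempty := by
  have hs : IsOpen {p : ℝ × ℝ | 0 < p.2 ∧ p.2 < p.1 ∧ p.1 < 1} :=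
    (isOpen_lt continuous_const continuous_snd).inter
      ((isOpen_lt continuous_snd continuous_fst).inter (isOpen_lt continuous_fst continuous_const))
  refine ⟨(2 / 3, 1 / 3), interior_maximal (fun p hp => ?_) hs (by norm_num)⟩
  obtain ⟨h1, h2, h3⟩ := hp
  exact ⟨⟨by linarith, by linarith⟩, ⟨by linarith, by linarith⟩, h2.le⟩

lemma uniqueDiffOn_triangle : UniqueDiffOn ℝ triangle :=
  uniqueDiffOn_convex convex_triangle interior_triangle_nonempty

lemma norm_partialDirection_le (j k : ℕ) (i : Fin (j + k)) :
    ‖(fun i : Fin (j + k) => if (i : ℕ) < j then ((1 : ℝ), (0 : ℝ)) else ((0 : ℝ), (1 : ℝ))) i‖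
      ≤ 1 := by
  simp only
  split_ifs <;> simp [Prod.norm_def]

lemma norm_le_add_abs (p q : ℝ × ℝ) : ‖p - q‖ ≤ |p.1 - q.1| + |p.2 - q.2| := by
  rw [Prod.norm_def]
  exact max_le (by simp) (by simp)

/-- Interpolation between a uniform bound and a Lipschitz bound, from `min 1 d ≤ d ^ β`. -/
lemma div_rpow_le {x d β B : ℝ} (hB : 0 ≤ B) (hd : 0 < d) (hβ0 : 0 ≤ β) (hβ1 : β ≤ 1)
    (h1 : x ≤ B) (h2 : x ≤ B * d) : x / d ^ β ≤ B := by
  rw [div_le_iff₀ (Real.rpow_pos_of_pos hd _)]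
  rcases le_total d 1 with h | h
  · have : d ≤ d ^ β := by
      simpa using Real.rpow_le_rpow_of_exponent_ge hd h hβ1
    exact h2.trans (mul_le_mul_of_nonneg_left this hB)
  · have : 1 ≤ d ^ β := Real.one_le_rpow h hβ0
    exact h1.trans (le_mul_of_one_le_right hB this)

lemma add_abs_pos {p q : ℝ × ℝ} (h : p ≠ q) : 0 < |p.1 - q.1| + |p.2 - q.2| :=
  (norm_pos_iff.2 (sub_ne_zero.2 h)).trans_le (norm_le_add_abs p q)

/-- Smooth functions with small derivatives lie in the Hölder class. -/
lemma mem_holderClass_of_contDiff {α M B : ℝ} (hα : 0 < α) {f : ℝ × ℝ → ℝ}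
    (hf : ContDiff ℝ (⌊α⌋₊ + 1 : ℕ) f) (hB : 0 ≤ B)
    (h0 : ∀ p ∈ triangle, |f p| ≤ M / 2)
    (h1 : ∀ i, 1 ≤ i → i ≤ ⌊α⌋₊ + 1 → ∀ p ∈ triangle, ‖iteratedFDeriv ℝ i f p‖ ≤ B)
    (hB' : 2 * B ≤ M / 2) (hosc : ∀ p ∈ triangle, ∀ q ∈ triangle, |f p - f q| ≤ 2 * B)
    (hs : ∀ x y, f (x, y) = f (y, x)) : f ∈ holderClass α M := by
  set l := ⌊α⌋₊ with hl
  have heq : ∀ i ≤ l + 1, ∀ p ∈ triangle,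
      iteratedFDerivWithin ℝ i f triangle p = iteratedFDeriv ℝ i f p := fun i hi p hp =>
    iteratedFDerivWithin_eq_iteratedFDeriv uniqueDiffOn_triangle
      ((hf.of_le (by exact_mod_cast hi)).contDiffAt) hp
  have happ : ∀ j k, j + k ≤ l + 1 → ∀ p ∈ triangle, partialDeriv j k f p =
      iteratedFDeriv ℝ (j + k) f p
        (fun i => if (i : ℕ) < j then ((1 : ℝ), (0 : ℝ)) else ((0 : ℝ), (1 : ℝ))) := by
    intro j k hjk p hp
    rw [partialDeriv, heq _ hjk p hp]
  have hbd : ∀ j k, j + k ≤ l → ∀ p ∈ triangle, |partialDeriv j k f p| ≤ M / 2 := by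
    intro j k hjk p hp
    rw [happ j k (by omega) p hp]
    rcases Nat.eq_zero_or_pos (j + k) with h | h
    · obtain ⟨rfl, rfl⟩ : j = 0 ∧ k = 0 := by omega
      simpa using h0 p hp
    · have := ContinuousMultilinearMap.le_mul_prod_of_opNorm_le_of_le
        (h1 _ h (by omega) p hp) (norm_partialDirection_le j k)
      simp only [Finset.prod_const_one, mul_one, Real.norm_eq_abs] at this
      linarith
  have hdiff : ∀ j k, j + k = l → ∀ p ∈ triangle, ∀ q ∈ triangle,
      |partialDeriv j k f p - partialDeriv j k f q| ≤ 2 * B ∧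
      |partialDeriv j k f p - partialDeriv j k f q| ≤ 2 * B * (|p.1 - q.1| + |p.2 - q.2|) := by
    intro j k hjk p hp q hq
    rw [happ j k (by omega) p hp, happ j k (by omega) q hq,
      ← sub_apply]
    have hle : ∀ C, ‖iteratedFDeriv ℝ (j + k) f p - iteratedFDeriv ℝ (j + k) f q‖ ≤ C →
        |(iteratedFDeriv ℝ (j + k) f p - iteratedFDeriv ℝ (j + k) f q)
          (fun i => if (i : ℕ) < j then ((1 : ℝ), (0 : ℝ)) else ((0 : ℝ), (1 : ℝ)))| ≤ C := by
      intro C hC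
      have := ContinuousMultilinearMap.le_mul_prod_of_opNorm_le_of_le
        hC (norm_partialDirection_le j k)
      simpa using this
    constructor
    -- The bound `B` covers derivatives of order at least one only. At order zero, which is the top
    -- order when `α < 1`, the oscillation hypothesis takes its place.
    · rcases Nat.eq_zero_or_pos (j + k) with h | h
      · obtain ⟨rfl, rfl⟩ : j = 0 ∧ k = 0 := by omega
        simpa using hosc p hp q hq
      · refine hle _ ((norm_sub_le _ _).trans ?_)
        linarith [h1 _ h (by omega) p hp, h1 _ h (by omega) q hq]
    · refine hle _ ?_
      have hmv := convex_triangle.norm_image_sub_le_of_norm_fderiv_le (𝕜 := ℝ)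
        (f := iteratedFDeriv ℝ (j + k) f) (C := B) (x := q) (y := p)
        (fun x _ => (hf.differentiable_iteratedFDeriv (by exact_mod_cast (by omega))) x)
        (fun x hx => by
          rw [norm_fderiv_iteratedFDeriv]
          exact h1 _ (by omega) (by omega) x hx) hq hp
      refine hmv.trans ?_
      have := norm_le_add_abs p q
      have h3 := norm_nonneg (p - q)
      nlinarith
  refine ⟨?_, ?_, fun x _ y _ => hs x y⟩
  · intro i hi
    have : DifferentiableOn ℝ (iteratedFDeriv ℝ i f) triangle :=
      (hf.differentiable_iteratedFDeriv (by exact_mod_cast (by omega))).differentiableOn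
    exact this.congr fun p hp => heq i (by omega) p hp
  · have hM : ENNReal.ofReal M = ENNReal.ofReal (M / 2) + ENNReal.ofReal (M / 2) := by
      rw [← ENNReal.ofReal_add (by linarith) (by linarith)]; congr 1; ring
    unfold holderNorm
    rw [hM]
    refine add_le_add ?_ ?_
    · refine iSup_le fun j => iSup_le fun k => iSup_le fun hjk => iSup₂_le fun p hp => ?_
      exact ENNReal.ofReal_le_ofReal (hbd j k hjk p hp)
    · refine iSup_le fun j => iSup_le fun k => iSup_le fun hjk => iSup₂_le fun p hp =>
        iSup₂_le fun q hq => iSup_le fun hpq => ?_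
      obtain ⟨g1, g2⟩ := hdiff j k hjk p hp q hq
      refine ENNReal.ofReal_le_ofReal (le_trans ?_ hB')
      refine div_rpow_le (by linarith) (add_abs_pos hpq) ?_ ?_ g1 g2
      · exact sub_nonneg.2 (Nat.floor_le hα.le)
      · have := Nat.lt_floor_add_one α
        linarith

/-- The function is quadratic: its derivative is a linear map of norm at most `2 c`, and derivatives
of order three or more vanish. The form `D ^ i` is the one required by the composition bound for
iterated derivatives. -/
lemma norm_iteratedFDeriv_mul_const_le {c : ℝ} (hc : 0 ≤ c) {p : ℝ × ℝ} (hp : p ∈ triangle)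
    (i : ℕ) (hi : 1 ≤ i) :
    ‖iteratedFDeriv ℝ i (fun p : ℝ × ℝ => c * (p.1 * p.2)) p‖ ≤ (max 1 (2 * c)) ^ i := by
  set L : ℝ × ℝ →L[ℝ] (ℝ × ℝ →L[ℝ] ℝ) :=
    c • ((ContinuousLinearMap.fst ℝ ℝ ℝ).smulRight (ContinuousLinearMap.snd ℝ ℝ ℝ) +
      (ContinuousLinearMap.snd ℝ ℝ ℝ).smulRight (ContinuousLinearMap.fst ℝ ℝ ℝ)) with hL
  have hLn : ‖L‖ ≤ 2 * c := by
    refine ContinuousLinearMap.opNorm_le_bound₂ L (by positivity) fun x y => ?_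
    have e : L x y = c * (x.1 * y.2 + x.2 * y.1) := by simp [hL]; ring
    rw [e, norm_mul, Real.norm_of_nonneg hc]
    have h1 : ‖x.1 * y.2‖ ≤ ‖x‖ * ‖y‖ := by
      rw [norm_mul]
      exact mul_le_mul (norm_fst_le x) (norm_snd_le y) (norm_nonneg _) (norm_nonneg _)
    have h2 : ‖x.2 * y.1‖ ≤ ‖x‖ * ‖y‖ := by
      rw [norm_mul]
      exact mul_le_mul (norm_snd_le x) (norm_fst_le y) (norm_nonneg _) (norm_nonneg _)
    have h3 := norm_add_le (x.1 * y.2) (x.2 * y.1)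
    nlinarith
  have hfd : fderiv ℝ (fun p : ℝ × ℝ => c * (p.1 * p.2)) = L := by
    ext1 p
    have h := ((hasFDerivAt_fst (𝕜 := ℝ) (p := p)).mul
      (hasFDerivAt_snd (𝕜 := ℝ) (p := p))).const_mul c
    refine h.fderiv.trans ?_
    ext <;> simp [hL]
  have hp1 : ‖p‖ ≤ 1 := by
    obtain ⟨⟨h1, h2⟩, ⟨h3, h4⟩, -⟩ := hp
    rw [Prod.norm_def]
    exact max_le (by rw [Real.norm_of_nonneg h1]; exact h2)
      (by rw [Real.norm_of_nonneg h3]; exact h4)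
  have hm : 2 * c ≤ max 1 (2 * c) := le_max_right _ _
  have hm1 : 1 ≤ max 1 (2 * c) := le_max_left _ _
  have hpow : max 1 (2 * c) ≤ max 1 (2 * c) ^ i := le_self_pow₀ hm1 (by omega)
  obtain ⟨k, rfl⟩ : ∃ k, i = k + 1 := ⟨i - 1, by omega⟩
  rw [← norm_iteratedFDeriv_fderiv, hfd]
  rcases k with _ | k
  · rw [norm_iteratedFDeriv_zero]
    refine (L.le_of_opNorm_le hLn p).trans ?_
    nlinarith [norm_nonneg p]
  · rw [← norm_iteratedFDeriv_fderiv, show fderiv ℝ (L : ℝ × ℝ → _) = fun _ => L by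
      ext1 x; exact L.fderiv]
    rcases k with _ | k
    · rw [norm_iteratedFDeriv_zero]; linarith
    · rw [iteratedFDeriv_const_of_ne (by omega)]
      simp only [Pi.zero_apply, norm_zero]
      positivity

lemma norm_iteratedFDeriv_cos_le {c : ℝ} (hc : 0 ≤ c) {p : ℝ × ℝ} (hp : p ∈ triangle) (i : ℕ) :
    ‖iteratedFDeriv ℝ i (fun p : ℝ × ℝ => Real.cos (c * (p.1 * p.2))) p‖
      ≤ i.factorial * (max 1 (2 * c)) ^ i := by
  have := norm_iteratedFDeriv_comp_le (𝕜 := ℝ) (g := Real.cos)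
    (f := fun p : ℝ × ℝ => c * (p.1 * p.2)) (n := i) (N := i) Real.contDiff_cos
    (by fun_prop) le_rfl p (C := 1) (D := max 1 (2 * c)) (fun j _ => by
      rw [norm_iteratedFDeriv_eq_norm_iteratedDeriv]
      exact Real.abs_iteratedDeriv_cos_le_one j _)
    (fun j hj _ => norm_iteratedFDeriv_mul_const_le hc hp j hj)
  simpa [Function.comp_def] using this

/-- The graphon `(x, y) ↦ q + d cos (c x y)`. -/
noncomputable def cosGraphon (q d c : ℝ) (p : ℝ × ℝ) : ℝ := q + d * Real.cos (c * (p.1 * p.2))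

/-- All derivatives up to order `⌊α⌋ + 1` are at most `B = d (⌊α⌋ + 1)! D ^ (⌊α⌋ + 1)`; the extra
order controls the Hölder quotient through the mean value inequality. -/
lemma cosGraphon_mem {α M q d c : ℝ} (hα : 0 < α) (hd : 0 ≤ d) (hc : 0 ≤ c) (hq : 2 * q ≤ 1)
    (hqM : 4 * q ≤ M) (hdq : d ≤ q)
    (hB : 4 * (d * ((⌊α⌋₊ + 1).factorial * (max 1 (2 * c)) ^ (⌊α⌋₊ + 1))) ≤ M) :
    cosGraphon q d c ∈ graphonClass α M := by
  set l := ⌊α⌋₊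
  set D := max 1 (2 * c) with hD
  have hD1 : 1 ≤ D := le_max_left _ _
  have hcos : ∀ p, |cosGraphon q d c p - q| ≤ d := by
    intro p
    rw [cosGraphon, add_sub_cancel_left, abs_mul, abs_of_nonneg hd]
    exact mul_le_of_le_one_right hd (Real.abs_cos_le_one _)
  have hBd : d ≤ d * ((l + 1).factorial * D ^ (l + 1)) := by
    refine le_mul_of_one_le_right hd ?_
    have h1 : (1 : ℝ) ≤ (l + 1).factorial := by exact_mod_cast Nat.one_le_iff_ne_zero.2 (Nat.factorial_ne_zero _)
    have h2 : 1 ≤ D ^ (l + 1) := one_le_pow₀ hD1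
    nlinarith
  refine ⟨mem_holderClass_of_contDiff hα (B := d * ((l + 1).factorial * D ^ (l + 1)))
    ?_ (hd.trans hBd) ?_ ?_ ?_ ?_ ?_, ?_⟩
  · unfold cosGraphon; fun_prop
  · intro p _
    have := abs_le.1 (hcos p)
    rw [abs_le]; constructor <;> linarith
  · intro i hi1 hi2 p hp
    have e : cosGraphon q d c = fun p : ℝ × ℝ => q + d • Real.cos (c * (p.1 * p.2)) := rfl
    have hcd : ContDiffAt ℝ i (fun p : ℝ × ℝ => Real.cos (c * (p.1 * p.2))) p := by fun_prop
    rw [e]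
    have e2 : iteratedFDeriv ℝ i (fun p : ℝ × ℝ => q + d • Real.cos (c * (p.1 * p.2))) p
        = d • iteratedFDeriv ℝ i (fun p : ℝ × ℝ => Real.cos (c * (p.1 * p.2))) p := by
      rw [fun_iteratedFDeriv_add_apply (by fun_prop) (by fun_prop),
        iteratedFDeriv_const_of_ne (by omega), iteratedFDeriv_const_smul_apply' hcd]
      simp
    rw [e2, norm_smul, Real.norm_of_nonneg hd]
    gcongr
    refine (norm_iteratedFDeriv_cos_le hc hp i).trans ?_
    gcongr
  · linarith only [hB]
  · intro p _ r _
    have h1 := abs_le.1 (hcos p)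
    have h2 := abs_le.1 (hcos r)
    rw [abs_le]; constructor <;> linarith
  · intro x y; simp [cosGraphon, mul_comm x y]
  · intro x _ y _
    have := abs_le.1 (hcos (x, y))
    constructor <;> linarith


/-! ### The combined bound, and boundedly many nodes. -/

/-- The minimax error over the two classes is at least `r`, in probability and in expectation. -/
def MinimaxBound (α M : ℝ) (n k : ℕ) (l₁ l₂ δ r : ℝ) : Prop :=
  (ENNReal.ofReal 0.8 ≤ ⨅ T : Estimator n, ⨆ f ∈ graphonClass α M,
      ⨆ μ ∈ latentClass n k l₁ l₂ δ,
        jointLaw f μ {ω | r ≤ loss (T ω.2) (edgeProb f ω.1)}) ∧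
    (ENNReal.ofReal r ≤ ⨅ T : Estimator n, ⨆ f ∈ graphonClass α M,
      ⨆ μ ∈ latentClass n k l₁ l₂ δ,
        ∫⁻ ω, ENNReal.ofReal (loss (T ω.2) (edgeProb f ω.1)) ∂(jointLaw f μ))

lemma MinimaxBound.mono {α M : ℝ} {n k : ℕ} {l₁ l₂ δ r s : ℝ}
    (h : MinimaxBound α M n k l₁ l₂ δ r) (hsr : s ≤ r) : MinimaxBound α M n k l₁ l₂ δ s := by
  refine ⟨h.1.trans ?_, (ENNReal.ofReal_le_ofReal hsr).trans h.2⟩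
  gcongr

-- Markov's inequality costs the factor `0.8` in expectation; lowering the threshold in the
-- probability bound by the same factor lets both be stated with one number.
open Classical in
lemma minimaxBound_of_family {α M : ℝ} {n k : ℕ} {l₁ l₂ δ : ℝ} {V : Type*} [Fintype V] [Nonempty V]
    (f : V → ℝ × ℝ → ℝ) (ξ : V → Fin n → I) (hf : ∀ v, f v ∈ graphonClass α M)
    (hξ : ∀ v, ξ v ∈ wellSpread n k l₁ l₂) {q d r ρ : ℝ} (hq0 : 0 < q) (hq1 : q < 1) (hr : 0 ≤ r)
    (hd : ∀ v, ∀ i j, i ≠ j → |f v (ξ v i, ξ v j) - q| ≤ d)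
    (hρ : ∀ T : Matrix (Fin n) (Fin n) ℝ,
      ((Finset.univ.filter fun v => loss T (edgeProb (f v) (ξ v)) < r).card : ℝ)
        ≤ ρ * Fintype.card V)
    (hχ : Real.exp ((n : ℝ) ^ 2 * d ^ 2 / (q * (1 - q))) * ρ ≤ 1 / 25) :
    MinimaxBound α M n k l₁ l₂ δ (0.8 * r) := by
  obtain ⟨h1, h2⟩ := minimax_lower_bound (δ := δ) f ξ hf hξ hq0 hq1 hr hd hρ hχ
  refine ⟨h1.trans ?_, h2⟩
  gcongr
  linarith

lemma sq_sub_le_loss {n : ℕ} (hn : 1 ≤ n) (T θ : Matrix (Fin n) (Fin n) ℝ) (i j : Fin n) :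
    (T i j - θ i j) ^ 2 ≤ (n : ℝ) ^ 2 * loss T θ := by
  have hn' : (0 : ℝ) < n := by exact_mod_cast hn
  have : (n : ℝ) ^ 2 * loss T θ = ∑ i, ∑ j, (T i j - θ i j) ^ 2 := by
    unfold loss; field_simp
  rw [this]
  refine le_trans ?_ (Finset.single_le_sum (f := fun i => ∑ j, (T i j - θ i j) ^ 2)
    (fun i _ => Finset.sum_nonneg fun j _ => sq_nonneg _) (Finset.mem_univ i))
  exact Finset.single_le_sum (f := fun j => (T i j - θ i j) ^ 2)
    (fun j _ => sq_nonneg _) (Finset.mem_univ j)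

/-- A lower bound for boundedly many nodes, from the constant graphons. -/
lemma exists_minimaxBound_of_le {M α : ℝ} (hM : 0 < M) (hα : 0 < α) {n₀ : ℕ} (hn₀ : 1 ≤ n₀) :
    ∃ r : ℝ, 0 < r ∧ ∀ (n k : ℕ) (l₁ l₂ δ : ℝ), 2 ≤ n → n ≤ n₀ → 1 ≤ k → k ≤ n → 1 ≤ l₂ →
      (latentClass n k l₁ l₂ δ).Nonempty → MinimaxBound α M n k l₁ l₂ δ r := by
  classical
  set q : ℝ := min M 1 / 4 with hq
  have hq0 : 0 < q := by positivity
  have hqM : 4 * q ≤ M := by have := min_le_left M 1; linarith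
  have hq1 : 4 * q ≤ 1 := by have := min_le_right M 1; linarith
  set K : ℝ := (((⌊α⌋₊ + 1).factorial : ℕ) : ℝ) with hK
  have hK1 : 1 ≤ K := by
    rw [hK]; exact_mod_cast Nat.one_le_iff_ne_zero.2 (Nat.factorial_ne_zero _)
  have hn₀' : (1 : ℝ) ≤ n₀ := by exact_mod_cast hn₀
  -- Total range of the levels: `η K ≤ q` serves the Hölder bound, and `η n₀ ≤ q` keeps the second
  -- moment below `e ≤ 3`.
  set η : ℝ := q / (K * n₀) with hη
  have hη0 : 0 < η := by positivity
  have hηK : η * K ≤ q := by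
    rw [hη, div_mul_eq_mul_div, div_le_iff₀ (by positivity)]
    nlinarith [mul_pos hq0 (by linarith : 0 < K)]
  have hηn : η * n₀ ≤ q := by
    rw [hη, div_mul_eq_mul_div, div_le_iff₀ (by positivity)]
    nlinarith [mul_pos hq0 (by linarith : (0 : ℝ) < n₀)]
  have hηq : η ≤ q := by nlinarith
  -- There are `75 = 3 * 25` levels spaced by `η / 75`. Loss below `r` puts a single entry of `T`
  -- within half a spacing `η / 150` of its level, so one level at most qualifies and `ρ = 1 / 75`.
  set r : ℝ := η ^ 2 / (22500 * (n₀ : ℝ) ^ 2) with hr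
  have hr0 : 0 < r := by positivity
  refine ⟨0.8 * r, by positivity, fun n k l₁ l₂ δ hn hnn hk hkn hl₂ hne => ?_⟩
  obtain ⟨N, -, -, hN⟩ := exists_gridDesign_mem_wellSpread hk hkn hl₂ hne
  have hv : ∀ v : Fin 75, 0 ≤ η * ((v : ℕ) : ℝ) / 75 ∧ η * ((v : ℕ) : ℝ) / 75 ≤ η := by
    intro v
    have : ((v : ℕ) : ℝ) ≤ 75 := by exact_mod_cast v.2.le
    exact ⟨by positivity, by nlinarith⟩
  have hval : ∀ (v : Fin 75) p,
      cosGraphon q (η * ((v : ℕ) : ℝ) / 75) 0 p = q + η * ((v : ℕ) : ℝ) / 75 := by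
    intro v p; simp [cosGraphon]
  refine minimaxBound_of_family (V := Fin 75) (fun v => cosGraphon q (η * ((v : ℕ) : ℝ) / 75) 0)
    (fun _ => gridDesign N 1) (fun v => ?_) (fun _ => hN 1) (q := q) (d := η) (ρ := 1 / 75) hq0
    (by linarith) hr0.le (fun v i j _ => ?_) (fun T => ?_) ?_
  · refine cosGraphon_mem hα (hv v).1 le_rfl (by linarith) hqM ((hv v).2.trans hηq) ?_
    simp only [mul_zero]
    rw [max_eq_left (by norm_num), one_pow, mul_one]
    have := mul_le_mul_of_nonneg_right (hv v).2 (by linarith : 0 ≤ K)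
    linarith
  · rw [hval, add_sub_cancel_left, abs_of_nonneg (hv v).1]; exact (hv v).2
  · have : (Finset.univ.filter fun v : Fin 75 => loss T (edgeProb
        (cosGraphon q (η * ((v : ℕ) : ℝ) / 75) 0) (gridDesign N (1 : Equiv.Perm (Fin n)))) < r).card
        ≤ 1 := by
      rw [Finset.card_le_one]
      intro v hv w hw
      simp only [Finset.mem_filter, Finset.mem_univ, true_and] at hv hw
      have hnp : (0 : ℝ) < n := by exact_mod_cast (by omega : 0 < n)
      have hb : (n : ℝ) ^ 2 * r ≤ η ^ 2 / 22500 := by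
        have : (n : ℝ) ^ 2 ≤ (n₀ : ℝ) ^ 2 := by gcongr
        calc _ ≤ (n₀ : ℝ) ^ 2 * r := by gcongr
          _ = _ := by rw [hr]; field_simp
      have h1 := (sq_sub_le_loss (by omega) _ _ ⟨0, by omega⟩ ⟨1, by omega⟩).trans_lt
        ((mul_lt_mul_of_pos_left hv (by positivity)).trans_le hb)
      have h2 := (sq_sub_le_loss (by omega) _ _ ⟨0, by omega⟩ ⟨1, by omega⟩).trans_lt
        ((mul_lt_mul_of_pos_left hw (by positivity)).trans_le hb)
      simp only [edgeProb, Matrix.of_apply, Fin.mk.injEq, zero_ne_one, if_false, hval] at h1 h2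
      have e : η ^ 2 / 22500 = (η / 150) ^ 2 := by ring
      rw [e] at h1 h2
      have g1 := abs_lt.1 (abs_lt_of_sq_lt_sq h1 (by positivity))
      have g2 := abs_lt.1 (abs_lt_of_sq_lt_sq h2 (by positivity))
      have k1 : η * ((v : ℕ) : ℝ) < η * (((w : ℕ) : ℝ) + 1) := by linarith [g1.1, g2.2]
      have k2 : η * ((w : ℕ) : ℝ) < η * (((v : ℕ) : ℝ) + 1) := by linarith [g1.2, g2.1]
      have k3 : (v : ℕ) < w + 1 := by exact_mod_cast lt_of_mul_lt_mul_left k1 hη0.le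
      have k4 : (w : ℕ) < v + 1 := by exact_mod_cast lt_of_mul_lt_mul_left k2 hη0.le
      ext; omega
    simp only [Fintype.card_fin]
    norm_num
    exact_mod_cast this
  · have h1 : (n : ℝ) ^ 2 * η ^ 2 / (q * (1 - q)) ≤ 1 := by
      rw [div_le_one (mul_pos hq0 (by linarith))]
      have hnn' : (n : ℝ) ≤ n₀ := by exact_mod_cast hnn
      have : (n : ℝ) ^ 2 * η ^ 2 ≤ q ^ 2 := by
        rw [← mul_pow]
        refine pow_le_pow_left₀ (by positivity) ?_ 2
        nlinarith
      nlinarith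
    have h2 : Real.exp ((n : ℝ) ^ 2 * η ^ 2 / (q * (1 - q))) ≤ 3 :=
      (Real.exp_le_exp.2 h1).trans (Real.exp_one_lt_d9.le.trans (by norm_num))
    linarith


/-! ### Tents and rough graphons. -/

/-- The distance from `u` to the nearest integer. -/
noncomputable def tent (u : ℝ) : ℝ := min (Int.fract u) (1 - Int.fract u)

lemma tent_nonneg (u : ℝ) : 0 ≤ tent u :=
  le_min (Int.fract_nonneg u) (by linarith [Int.fract_lt_one u])

lemma tent_le_one (u : ℝ) : tent u ≤ 1 := (min_le_left _ _).trans (Int.fract_lt_one u).le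

lemma abs_tent_sub_le {u v : ℝ} (h : ⌊u⌋ = ⌊v⌋) : |tent u - tent v| ≤ |u - v| := by
  unfold tent Int.fract
  rw [h]
  refine (abs_min_sub_min_le_max _ _ _ _).trans (max_le ?_ ?_)
  · rw [sub_sub_sub_cancel_right]
  · rw [sub_sub_sub_cancel_left, sub_sub_sub_cancel_right, abs_sub_comm]

/-- Some integer separates `u` from `v`, so `u` is at least as close to the integers as to `v`. -/
lemma tent_le_abs_sub {u v : ℝ} (h : ⌊u⌋ ≠ ⌊v⌋) : tent u ≤ |u - v| := by
  have h1 := Int.floor_le u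
  have h2 := Int.lt_floor_add_one u
  have h3 := Int.floor_le v
  have h4 := Int.lt_floor_add_one v
  unfold tent Int.fract
  rcases lt_or_gt_of_ne h with h | h
  · have : (⌊u⌋ : ℝ) + 1 ≤ ⌊v⌋ := by exact_mod_cast h
    refine (min_le_right _ _).trans (le_trans ?_ (neg_le_abs _))
    linarith
  · have : (⌊v⌋ : ℝ) + 1 ≤ ⌊u⌋ := by exact_mod_cast h
    refine (min_le_left _ _).trans (le_trans ?_ (le_abs_self _))
    linarith

/-- A sum of tensor products of tents over the unit squares, with coefficients `s`. -/
noncomputable def tentSum (s : ℤ → ℤ → ℝ) (x y : ℝ) : ℝ := s ⌊x⌋ ⌊y⌋ * (tent x * tent y)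

lemma abs_tentSum_le {s : ℤ → ℤ → ℝ} (hs : ∀ a b, |s a b| ≤ 1) (x y : ℝ) :
    |tentSum s x y| ≤ tent x * tent y := by
  have h := mul_nonneg (tent_nonneg x) (tent_nonneg y)
  rw [tentSum, abs_mul, abs_of_nonneg h]
  exact mul_le_of_le_one_left h (hs _ _)

lemma tent_mul_le_left (x y : ℝ) : tent x * tent y ≤ tent x :=
  mul_le_of_le_one_right (tent_nonneg x) (tent_le_one y)

lemma tent_mul_le_right (x y : ℝ) : tent x * tent y ≤ tent y :=
  mul_le_of_le_one_left (tent_nonneg y) (tent_le_one x)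

/-- Within one unit square this is the product rule. Across squares the coefficients are unrelated,
but both values are small because each tent vanishes on the integers. -/
lemma abs_tentSum_sub_le {s : ℤ → ℤ → ℝ} (hs : ∀ a b, |s a b| ≤ 1) (x y x' y' : ℝ) :
    |tentSum s x y - tentSum s x' y'| ≤ 2 * (|x - x'| + |y - y'|) := by
  have hx := abs_nonneg (x - x')
  have hy := abs_nonneg (y - y')
  have h1 := abs_tentSum_le hs x y
  have h2 := abs_tentSum_le hs x' y'
  have h3 := abs_sub (tentSum s x y) (tentSum s x' y')
  by_cases hxx : ⌊x⌋ = ⌊x'⌋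
  · by_cases hyy : ⌊y⌋ = ⌊y'⌋
    · have e : tentSum s x y - tentSum s x' y' =
          s ⌊x⌋ ⌊y⌋ * ((tent x - tent x') * tent y + tent x' * (tent y - tent y')) := by
        unfold tentSum; rw [← hxx, ← hyy]; ring
      have g1 : |(tent x - tent x') * tent y| ≤ |x - x'| := by
        rw [abs_mul, abs_of_nonneg (tent_nonneg y)]
        exact (mul_le_of_le_one_right (abs_nonneg _) (tent_le_one y)).trans (abs_tent_sub_le hxx)
      have g2 : |tent x' * (tent y - tent y')| ≤ |y - y'| := by
        rw [abs_mul, abs_of_nonneg (tent_nonneg x')]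
        exact (mul_le_of_le_one_left (abs_nonneg _) (tent_le_one x')).trans (abs_tent_sub_le hyy)
      rw [e, abs_mul]
      refine (mul_le_of_le_one_left (abs_nonneg _) (hs _ _)).trans ((abs_add_le _ _).trans ?_)
      linarith
    · have g1 := (tent_mul_le_right x y).trans (tent_le_abs_sub hyy)
      have g2 := (tent_mul_le_right x' y').trans (tent_le_abs_sub (Ne.symm hyy))
      rw [abs_sub_comm] at g2
      linarith
  · have g1 := (tent_mul_le_left x y).trans (tent_le_abs_sub hxx)
    have g2 := (tent_mul_le_left x' y').trans (tent_le_abs_sub (Ne.symm hxx))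
    rw [abs_sub_comm] at g2
    linarith

/-- The symmetric graphon made of tents of height `d` and width `1 / K` around the level `q`. -/
noncomputable def tentGraphon (q d K : ℝ) (s : ℤ → ℤ → ℝ) (p : ℝ × ℝ) : ℝ :=
  q + d * tentSum s (K * max p.1 p.2) (K * min p.1 p.2)

lemma abs_tentGraphon_sub_le {q d K : ℝ} {s : ℤ → ℤ → ℝ} (hs : ∀ a b, |s a b| ≤ 1) (hd : 0 ≤ d)
    (p : ℝ × ℝ) : |tentGraphon q d K s p - q| ≤ d := by
  rw [tentGraphon, add_sub_cancel_left, abs_mul, abs_of_nonneg hd]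
  refine mul_le_of_le_one_right hd ((abs_tentSum_le hs _ _).trans ?_)
  exact (tent_mul_le_left _ _).trans (tent_le_one _)

lemma tentGraphon_mem {α M q d K : ℝ} {s : ℤ → ℤ → ℝ} (hs : ∀ a b, |s a b| ≤ 1) (hα : 0 < α)
    (hα1 : α < 1) (hK : 0 < K) (hd : 0 ≤ d) (hq : 2 * q ≤ 1) (hqM : 4 * q ≤ M) (hdq : d ≤ q)
    (hdM : 4 * (d * K ^ α) ≤ M) : tentGraphon q d K s ∈ graphonClass α M := by
  have hfl : ⌊α⌋₊ = 0 := Nat.floor_eq_zero.2 hα1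
  have hq' := fun p => abs_le.1 (abs_tentGraphon_sub_le (q := q) (K := K) hs hd p)
  refine ⟨⟨?_, ?_, ?_⟩, ?_⟩
  · rw [hfl]; intro l hl; omega
  · have hM : ENNReal.ofReal M = ENNReal.ofReal (M / 2) + ENNReal.ofReal (M / 2) := by
      rw [← ENNReal.ofReal_add (by linarith) (by linarith)]; congr 1; ring
    have hval : ∀ p, partialDeriv 0 0 (tentGraphon q d K s) p = tentGraphon q d K s p := by
      intro p; simp [partialDeriv]
    unfold holderNorm
    rw [hM]
    refine add_le_add ?_ ?_
    · refine iSup_le fun j => iSup_le fun k => iSup_le fun hjk => iSup₂_le fun p hp => ?_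
      obtain ⟨rfl, rfl⟩ : j = 0 ∧ k = 0 := by omega
      rw [hval]
      refine ENNReal.ofReal_le_ofReal (abs_le.2 ⟨?_, ?_⟩) <;> linarith [hq' p]
    · refine iSup_le fun j => iSup_le fun k => iSup_le fun hjk => iSup₂_le fun p hp =>
        iSup₂_le fun r hr => iSup_le fun hpr => ?_
      obtain ⟨rfl, rfl⟩ : j = 0 ∧ k = 0 := by omega
      rw [hval, hval, hfl, Nat.cast_zero, sub_zero]
      refine ENNReal.ofReal_le_ofReal ?_
      have hD := add_abs_pos hpr
      set D := |p.1 - r.1| + |p.2 - r.2| with hDdef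
      have h1 : |tentGraphon q d K s p - tentGraphon q d K s r| ≤ 2 * d := by
        refine abs_le.2 ⟨?_, ?_⟩ <;> linarith [hq' p, hq' r]
      have h2 : |tentGraphon q d K s p - tentGraphon q d K s r| ≤ 2 * d * (K * D) := by
        unfold tentGraphon
        rw [max_eq_left hp.2.2, min_eq_right hp.2.2, max_eq_left hr.2.2, min_eq_right hr.2.2,
          add_sub_add_left_eq_sub, ← mul_sub, abs_mul, abs_of_nonneg hd]
        have := abs_tentSum_sub_le hs (K * p.1) (K * p.2) (K * r.1) (K * r.2)
        rw [← mul_sub, ← mul_sub, abs_mul, abs_mul, abs_of_pos hK] at this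
        calc _ ≤ d * _ := mul_le_mul_of_nonneg_left this hd
          _ = _ := by rw [hDdef]; ring
      -- Interpolating in the rescaled distance `K * D` yields the Hölder constant `2 d K^α ≤ M /
      -- 2`.
      have h3 := div_rpow_le (by positivity) (mul_pos hK hD) hα.le hα1.le h1 h2
      rw [Real.mul_rpow hK.le hD.le] at h3
      have hKα := Real.rpow_pos_of_pos hK α
      have hDα := Real.rpow_pos_of_pos hD α
      rw [div_le_iff₀ (by positivity)] at h3 ⊢
      nlinarith
  · intro x _ y _
    simp [tentGraphon, max_comm x y, min_comm x y]
  · intro x _ y _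
    constructor <;> linarith [hq' (x, y)]

/-! ### Random signs and the nonparametric rate. -/

/-- An exponential moment bound: if the loss `X v` of a point `v` of the hypercube is at least a sum
of coordinate losses which cannot all be small for both values of the coordinate, then few `v` have
small loss. -/
lemma card_hypercube_lt_le {E : Type*} [Fintype E] [DecidableEq E] (X : (E → Bool) → ℝ)
    (Y : E → Bool → ℝ) (hX : ∀ v, ∑ e, Y e (v e) ≤ X v) (hY : ∀ e b, 0 ≤ Y e b) {W : ℝ} (hW : 0 < W)
    (hYW : ∀ e, 2 * W ≤ Y e true + Y e false) :
    ((Finset.univ.filter fun v => X v < Fintype.card E * W / 8).card : ℝ) ≤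
      (3 / 4 : ℝ) ^ Fintype.card E * Fintype.card (E → Bool) := by
  obtain ⟨m, hm⟩ : ∃ m, m = Fintype.card E := ⟨_, rfl⟩
  rw [← hm]
  -- With `exp (-s W) = 1 / 4` each coordinate contributes at most `1 + 1 / 4`, since one of its two
  -- values costs at least `W`. The threshold costs `4 ^ (1/8) ≤ 6 / 5` per coordinate, and `(6/5)
  -- (5/4) = 2 (3/4)`.
  set s : ℝ := Real.log 4 / W with hs
  have hs0 : 0 < s := div_pos (Real.log_pos (by norm_num)) hW
  have hsW : s * W = Real.log 4 := by rw [hs]; field_simp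
  have hquart : Real.exp (-(s * W)) = 1 / 4 := by
    rw [hsW, Real.exp_neg, Real.exp_log (by norm_num)]; norm_num
  have hfac : ∀ e, Real.exp (-(s * Y e true)) + Real.exp (-(s * Y e false)) ≤ 5 / 4 := by
    intro e
    have hone : ∀ b, Real.exp (-(s * Y e b)) ≤ 1 := fun b =>
      Real.exp_le_one_iff.2 (by have := hY e b; simp; positivity)
    have hsmall : ∀ b, W ≤ Y e b → Real.exp (-(s * Y e b)) ≤ 1 / 4 := fun b hb => by
      rw [← hquart]
      exact Real.exp_le_exp.2 (neg_le_neg (mul_le_mul_of_nonneg_left hb hs0.le))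
    rcases le_or_gt W (Y e true) with h | h
    · linarith [hsmall true h, hone false]
    · linarith [hsmall false (by linarith [hYW e]), hone true]
  have hroot : Real.exp (s * (W / 8)) ≤ 6 / 5 := by
    have h1 : Real.exp (s * (W / 8)) ^ 8 = 4 := by
      rw [← Real.exp_nat_mul]
      have : ((8 : ℕ) : ℝ) * (s * (W / 8)) = Real.log 4 := by rw [← hsW]; push_cast; ring
      rw [this, Real.exp_log (by norm_num)]
    by_contra! hcon
    have := pow_lt_pow_left₀ hcon (by norm_num) (n := 8) (by norm_num)
    rw [h1] at this
    norm_num at this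
  have hcard : (Fintype.card (E → Bool) : ℝ) = 2 ^ m := by simp [hm]
  generalize hS : (Finset.univ.filter fun v => X v < m * W / 8) = S
  have hmem : ∀ v ∈ S, X v < m * W / 8 := fun v hv => by
    rw [← hS] at hv; exact (Finset.mem_filter.1 hv).2
  have h1 : (S.card : ℝ) ≤ ∑ v ∈ S,
      Real.exp (s * (m * W / 8)) * ∏ e, Real.exp (-(s * Y e (v e))) := by
    rw [Finset.card_eq_sum_ones, Nat.cast_sum]
    refine Finset.sum_le_sum fun v hv => ?_
    rw [← Real.exp_sum, ← Real.exp_add, Nat.cast_one]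
    refine Real.one_le_exp ?_
    rw [Finset.sum_neg_distrib, ← Finset.mul_sum, ← sub_eq_add_neg, ← mul_sub]
    have := hmem v hv
    exact mul_nonneg hs0.le (by linarith [hX v])
  have h2 : ∑ v ∈ S, Real.exp (s * (m * W / 8)) * ∏ e, Real.exp (-(s * Y e (v e))) ≤
      ∑ v : E → Bool, Real.exp (s * (m * W / 8)) * ∏ e, Real.exp (-(s * Y e (v e))) :=
    Finset.sum_le_univ_sum_of_nonneg fun v => by positivity
  have h3 : ∑ v : E → Bool, Real.exp (s * (m * W / 8)) * ∏ e, Real.exp (-(s * Y e (v e))) =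
      Real.exp (s * (W / 8)) ^ m *
          ∏ e, (Real.exp (-(s * Y e true)) + Real.exp (-(s * Y e false))) := by
    rw [← Finset.mul_sum, sum_prod_bool fun e b => Real.exp (-(s * Y e b)), ← Real.exp_nat_mul]
    congr 2; ring
  have h4 : ∏ e, (Real.exp (-(s * Y e true)) + Real.exp (-(s * Y e false))) ≤ (5 / 4 : ℝ) ^ m := by
    rw [hm, ← Finset.card_univ, ← Finset.prod_const]
    exact Finset.prod_le_prod (fun e _ => by positivity) fun e _ => hfac e
  have h5 : Real.exp (s * (W / 8)) ^ m ≤ (6 / 5) ^ m :=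
    pow_le_pow_left₀ (Real.exp_pos _).le hroot _
  have h6 : (3 / 4 : ℝ) ^ m * 2 ^ m = (6 / 5) ^ m * (5 / 4) ^ m := by
    rw [← mul_pow, ← mul_pow]; norm_num
  rw [hcard, h6]
  refine h1.trans (h2.trans (h3.le.trans ?_))
  exact mul_le_mul h5 h4 (Finset.prod_nonneg fun e _ => by positivity) (by positivity)


/-- The sign of a truth value. -/
noncomputable def boolSign (b : Bool) : ℝ := if b then 1 else -1

/-- The coefficient array with signs `v` on the unit squares with lower left corner `(K + a, b)`,
where `a, b < K`, and zero elsewhere. -/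
noncomputable def signArray {K : ℕ} (v : Fin K × Fin K → Bool) (a b : ℤ) : ℝ :=
  if h : ((K : ℤ) ≤ a ∧ a < 2 * K) ∧ 0 ≤ b ∧ b < K then
    boolSign (v (⟨(a - K).toNat, by omega⟩, ⟨b.toNat, by omega⟩)) else 0

lemma abs_signArray_le {K : ℕ} (v : Fin K × Fin K → Bool) (a b : ℤ) : |signArray v a b| ≤ 1 := by
  unfold signArray boolSign
  split_ifs <;> simp

lemma signArray_apply {K : ℕ} (v : Fin K × Fin K → Bool) (a b : Fin K) :
    signArray v ((K : ℤ) + (a : ℕ)) ((b : ℕ) : ℤ) = boolSign (v (a, b)) := by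
  have ha := a.2
  have hb := b.2
  unfold signArray
  rw [dif_pos (by omega)]
  congr 3
  ext
  simp

/-- The nodes whose grid position lies in the middle half of `[c / L, (c + 1) / L]`. -/
noncomputable def middleNodes (n N L c : ℕ) : Finset (Fin n) := by
  classical
  exact Finset.univ.filter fun i => (i : ℕ) < N ∧ (c : ℝ) + 1 / 4 ≤ L * ((i : ℕ) / N : ℝ) ∧
    L * ((i : ℕ) / N : ℝ) ≤ c + 3 / 4

lemma floor_tent_of_mem {c : ℕ} {u : ℝ} (h1 : (c : ℝ) + 1 / 4 ≤ u) (h2 : u ≤ c + 3 / 4) :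
    ⌊u⌋ = c ∧ 1 / 4 ≤ tent u := by
  have hf : ⌊u⌋ = (c : ℤ) := by
    rw [Int.floor_eq_iff]
    push_cast
    constructor <;> linarith
  refine ⟨hf, ?_⟩
  unfold tent Int.fract
  rw [hf, Int.cast_natCast]
  exact le_min (by linarith) (by linarith)

/-- The indices fill an interval of length `N / (2 L) ≥ 2`. Rounding at the ends loses at most one,
hence at most half of the length. -/
lemma card_middleNodes {n N L c : ℕ} (hN : N ≤ n) (hL : 0 < L) (hLN : 4 * L ≤ N) (hc : c < L) :
    (N : ℝ) / (4 * L) ≤ (middleNodes n N L c).card := by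
  classical
  have hL' : (0 : ℝ) < L := by exact_mod_cast hL
  have hN' : (0 : ℝ) < N := by exact_mod_cast (by omega : 0 < N)
  have hLN' : 4 * (L : ℝ) ≤ N := by exact_mod_cast hLN
  have hc' : (c : ℝ) + 1 ≤ L := by exact_mod_cast hc
  set A : ℝ := N * (c + 1 / 4) / L with hA
  set B : ℝ := N * (c + 3 / 4) / L with hB
  have hA0 : 0 ≤ A := by positivity
  have hB0 : 0 ≤ B := by positivity
  have hBN : B < N := by
    rw [hB, div_lt_iff₀ hL']; nlinarith
  have hsub : Finset.Icc ⌈A⌉₊ ⌊B⌋₊ ⊆ (middleNodes n N L c).image Fin.val := by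
    intro t ht
    rw [Finset.mem_Icc] at ht
    have h1 : A ≤ t := (Nat.le_ceil A).trans (by exact_mod_cast ht.1)
    have h2 : (t : ℝ) ≤ B := le_trans (by exact_mod_cast ht.2) (Nat.floor_le hB0)
    have h3 : t < N := by exact_mod_cast h2.trans_lt hBN
    refine Finset.mem_image.2 ⟨⟨t, by omega⟩, ?_, rfl⟩
    simp only [middleNodes, Finset.mem_filter, Finset.mem_univ, true_and]
    refine ⟨h3, ?_, ?_⟩
    · rw [hA, div_le_iff₀ hL'] at h1
      rw [← mul_div_assoc, le_div_iff₀ hN']; linarith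
    · rw [hB, le_div_iff₀ hL'] at h2
      rw [← mul_div_assoc, div_le_iff₀ hN']; linarith
  have h1 := (Finset.card_le_card hsub).trans Finset.card_image_le
  rw [Nat.card_Icc] at h1
  have h2 : ((⌊B⌋₊ + 1 : ℕ) : ℝ) ≤ ((middleNodes n N L c).card + ⌈A⌉₊ : ℕ) := by
    exact_mod_cast (by omega)
  push_cast at h2
  have h3 := Nat.lt_floor_add_one B
  have h4 := Nat.ceil_lt_add_one hA0
  have h5 : B - A = N / (2 * L) := by rw [hA, hB]; field_simp; ring
  have h6 : (N : ℝ) / (2 * L) = N / (4 * L) + N / (4 * L) := by field_simp; norm_num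
  have h7 : 1 ≤ (N : ℝ) / (4 * L) := by rw [le_div_iff₀ (by positivity)]; linarith
  linarith


lemma mem_middleNodes {n N L c : ℕ} {i : Fin n} : i ∈ middleNodes n N L c ↔
    (i : ℕ) < N ∧ (c : ℝ) + 1 / 4 ≤ L * ((i : ℕ) / N : ℝ) ∧
      L * ((i : ℕ) / N : ℝ) ≤ c + 3 / 4 := by
  simp [middleNodes]

lemma middleNodes_inj {n N L c c' : ℕ} {i : Fin n} (h : i ∈ middleNodes n N L c)
    (h' : i ∈ middleNodes n N L c') : c = c' := by
  have h1 := (floor_tent_of_mem (mem_middleNodes.1 h).2.1 (mem_middleNodes.1 h).2.2).1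
  have h2 := (floor_tent_of_mem (mem_middleNodes.1 h').2.1 (mem_middleNodes.1 h').2.2).1
  exact_mod_cast h1.symm.trans h2

lemma sq_mul_loss {n : ℕ} (hn : 1 ≤ n) (T θ : Matrix (Fin n) (Fin n) ℝ) :
    (n : ℝ) ^ 2 * loss T θ = ∑ p : Fin n × Fin n, (T p.1 p.2 - θ p.1 p.2) ^ 2 := by
  have hn' : (0 : ℝ) < n := by exact_mod_cast hn
  rw [Fintype.sum_prod_type]
  unfold loss; field_simp

/-- The part of the squared loss of `T` from the nodes in the middle of the square `e`, when that
square has sign `b`. -/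
noncomputable def squareLoss {n : ℕ} (N K : ℕ) (q d : ℝ) (T : Matrix (Fin n) (Fin n) ℝ)
    (e : Fin K × Fin K) (b : Bool) : ℝ :=
  ∑ p ∈ middleNodes n N (2 * K) (K + e.1) ×ˢ middleNodes n N (2 * K) e.2,
    (T p.1 p.2 - (q + d * (boolSign b * (tent ((2 * K : ℕ) * ((p.1 : ℕ) / N : ℝ)) *
      tent ((2 * K : ℕ) * ((p.2 : ℕ) / N : ℝ)))))) ^ 2

/-- The signed squares have first coordinate above `K` and second below `K` after scaling, so they
lie strictly inside the triangle: symmetrisation and the zero diagonal do not affect them. -/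
lemma edgeProb_tentGraphon {n N K : ℕ} {q d : ℝ} (v : Fin K × Fin K → Bool) (e : Fin K × Fin K)
    {p : Fin n × Fin n}
    (hp : p ∈ middleNodes n N (2 * K) (K + e.1) ×ˢ middleNodes n N (2 * K) e.2) :
    edgeProb (tentGraphon q d (2 * K : ℕ) (signArray v)) (gridDesign N 1) p.1 p.2 =
      q + d * (boolSign (v e) * (tent ((2 * K : ℕ) * ((p.1 : ℕ) / N : ℝ)) *
        tent ((2 * K : ℕ) * ((p.2 : ℕ) / N : ℝ)))) := by
  obtain ⟨h1, h2⟩ := Finset.mem_product.1 hp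
  obtain ⟨a1, b1, c1⟩ := mem_middleNodes.1 h1
  obtain ⟨a2, b2, c2⟩ := mem_middleNodes.1 h2
  have f1 := (floor_tent_of_mem b1 c1).1
  have f2 := (floor_tent_of_mem b2 c2).1
  have hK : 0 < K := by have := e.1.2; omega
  have he : ((e.2 : ℕ) : ℝ) + 1 ≤ K := by exact_mod_cast e.2.2
  have hlt : ((p.2 : ℕ) / N : ℝ) < ((p.1 : ℕ) / N : ℝ) := by
    have hK' : (0 : ℝ) < (2 * K : ℕ) := by exact_mod_cast (by omega)
    refine lt_of_mul_lt_mul_left ?_ hK'.le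
    push_cast at b1 c2 ⊢
    have : (0 : ℝ) ≤ (e.1 : ℕ) := Nat.cast_nonneg _
    linarith
  have hne : p.1 ≠ p.2 := fun h => by rw [h] at hlt; exact lt_irrefl _ hlt
  simp only [edgeProb, Matrix.of_apply, hne, if_false, gridDesign, Equiv.Perm.coe_one, id,
    gridPoint, a1, a2, if_true, tentGraphon]
  rw [max_eq_left hlt.le, min_eq_right hlt.le, tentSum, f1, f2]
  congr 3
  have := signArray_apply v e.1 e.2
  push_cast at this ⊢
  exact this

lemma sum_squareLoss_le {n N K : ℕ} (hn : 1 ≤ n) {q d : ℝ} (T : Matrix (Fin n) (Fin n) ℝ)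
    (v : Fin K × Fin K → Bool) :
    ∑ e, squareLoss N K q d T e (v e) ≤ (n : ℝ) ^ 2 * loss T
      (edgeProb (tentGraphon q d (2 * K : ℕ) (signArray v)) (gridDesign N 1)) := by
  classical
  rw [sq_mul_loss hn]
  set S : Fin K × Fin K → Finset (Fin n × Fin n) := fun e =>
    middleNodes n N (2 * K) (K + e.1) ×ˢ middleNodes n N (2 * K) e.2 with hS
  have hdisj : Set.PairwiseDisjoint ((Finset.univ : Finset (Fin K × Fin K)) : Set _) S := by
    intro e _ e' _ hee
    refine Finset.disjoint_left.2 fun p hp hp' => hee ?_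
    obtain ⟨h1, h2⟩ := Finset.mem_product.1 hp
    obtain ⟨h3, h4⟩ := Finset.mem_product.1 hp'
    have g1 := middleNodes_inj h1 h3
    have g2 := middleNodes_inj h2 h4
    ext <;> omega
  have h1 : ∑ e, squareLoss N K q d T e (v e) = ∑ e, ∑ p ∈ S e, (T p.1 p.2 - edgeProb
      (tentGraphon q d (2 * K : ℕ) (signArray v)) (gridDesign N 1) p.1 p.2) ^ 2 := by
    refine Finset.sum_congr rfl fun e _ => Finset.sum_congr rfl fun p hp => ?_
    rw [edgeProb_tentGraphon v e hp]
  rw [h1, ← Finset.sum_biUnion hdisj]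
  exact Finset.sum_le_univ_sum_of_nonneg fun p => sq_nonneg _

/-- For each entry, `(a - x)² + (a + x)² ≥ 2 x²`, where `x` is `d` times two tents that are each at
least `1 / 4`. -/
lemma squareLoss_add_ge {n N K : ℕ} (hN : N ≤ n) (hnN : n < 2 * N) (hK : 8 * K ≤ N) {q d : ℝ}
    (T : Matrix (Fin n) (Fin n) ℝ) (e : Fin K × Fin K) :
    2 * ((n : ℝ) / (16 * K)) ^ 2 * (d ^ 2 / 256) ≤
      squareLoss N K q d T e true + squareLoss N K q d T e false := by
  have hK0 : 0 < K := by have := e.1.2; omega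
  have hK' : (0 : ℝ) < K := by exact_mod_cast hK0
  unfold squareLoss
  rw [← Finset.sum_add_distrib]
  set S := middleNodes n N (2 * K) (K + e.1) ×ˢ middleNodes n N (2 * K) e.2 with hS
  have hcard : ((n : ℝ) / (16 * K)) ^ 2 ≤ S.card := by
    have h0 : (n : ℝ) / (16 * K) ≤ (N : ℝ) / (4 * (2 * K : ℕ)) := by
      rw [div_le_div_iff₀ (by positivity) (by positivity)]
      have : (n : ℝ) ≤ 2 * N := by exact_mod_cast hnN.le
      push_cast
      nlinarith
    have h1 := h0.trans (card_middleNodes (c := K + e.1) hN (by omega) (by omega)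
      (by have := e.1.2; omega))
    have h2 := h0.trans (card_middleNodes (c := e.2) hN (by omega) (by omega)
      (by have := e.2.2; omega))
    rw [hS, Finset.card_product, pow_two, Nat.cast_mul]
    exact mul_le_mul h1 h2 (by positivity) (by positivity)
  have hpt : ∀ p ∈ S, 2 * (d ^ 2 / 256) ≤
      (T p.1 p.2 - (q + d * (boolSign true * (tent ((2 * K : ℕ) * ((p.1 : ℕ) / N : ℝ)) *
        tent ((2 * K : ℕ) * ((p.2 : ℕ) / N : ℝ)))))) ^ 2 +
      (T p.1 p.2 - (q + d * (boolSign false * (tent ((2 * K : ℕ) * ((p.1 : ℕ) / N : ℝ)) *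
        tent ((2 * K : ℕ) * ((p.2 : ℕ) / N : ℝ)))))) ^ 2 := by
    intro p hp
    obtain ⟨h1, h2⟩ := Finset.mem_product.1 hp
    have t1 := (floor_tent_of_mem (mem_middleNodes.1 h1).2.1 (mem_middleNodes.1 h1).2.2).2
    have t2 := (floor_tent_of_mem (mem_middleNodes.1 h2).2.1 (mem_middleNodes.1 h2).2.2).2
    set t := tent ((2 * K : ℕ) * ((p.1 : ℕ) / N : ℝ))
    set u := tent ((2 * K : ℕ) * ((p.2 : ℕ) / N : ℝ))
    have htu : 1 / 16 ≤ t * u := by nlinarith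
    have htu2 : 1 / 256 ≤ (t * u) ^ 2 := by nlinarith
    have : d ^ 2 / 256 ≤ d ^ 2 * (t * u) ^ 2 := by nlinarith [sq_nonneg d]
    simp only [boolSign]
    simp
    nlinarith [sq_nonneg (T p.1 p.2 - q)]
  calc _ ≤ (S.card : ℝ) * (2 * (d ^ 2 / 256)) := by
        have : 0 ≤ d ^ 2 / 256 := by positivity
        nlinarith
    _ = ∑ p ∈ S, 2 * (d ^ 2 / 256) := by rw [Finset.sum_const, nsmul_eq_mul]
    _ ≤ _ := Finset.sum_le_sum hpt

/-- The lower bound from random signs on a `K × K` array of tents. -/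
lemma minimaxBound_tent {α M : ℝ} (hα : 0 < α) (hα1 : α < 1) {n k K : ℕ} {l₁ l₂ δ : ℝ}
    (hk : 1 ≤ k) (hkn : k ≤ n) (hl₂ : 1 ≤ l₂) (hne : (latentClass n k l₁ l₂ δ).Nonempty)
    (hK6 : 6 ≤ K) (hKn : 16 * K ≤ n) {q d : ℝ} (hq0 : 0 < q) (hq : 2 * q ≤ 1) (hqM : 4 * q ≤ M)
    (hd : 0 < d) (hdq : d ≤ q) (hdM : 4 * (d * ((2 * K : ℕ) : ℝ) ^ α) ≤ M)
    (hinfo : (n : ℝ) ^ 2 * d ^ 2 / (q * (1 - q)) ≤ (K : ℝ) ^ 2 / 8) :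
    MinimaxBound α M n k l₁ l₂ δ (0.8 * (d ^ 2 / 524288)) := by
  classical
  obtain ⟨N, hNn, hnN, hN⟩ := exists_gridDesign_mem_wellSpread hk hkn hl₂ hne
  have hK' : (0 : ℝ) < K := by exact_mod_cast (by omega : 0 < K)
  have hn' : (0 : ℝ) < n := by exact_mod_cast (by omega : 0 < n)
  set W : ℝ := ((n : ℝ) / (16 * K)) ^ 2 * (d ^ 2 / 256) with hW
  have hcardE : Fintype.card (Fin K × Fin K) = K ^ 2 := by simp [pow_two]
  refine minimaxBound_of_family (V := Fin K × Fin K → Bool)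
    (fun v => tentGraphon q d (2 * K : ℕ) (signArray v)) (fun _ => gridDesign N 1)
    (fun v => tentGraphon_mem (abs_signArray_le v) hα hα1
      (by exact_mod_cast (by omega : 0 < 2 * K)) hd.le hq hqM hdq hdM)
    (fun _ => hN 1) (q := q) (d := d) (ρ := (3 / 4 : ℝ) ^ (K ^ 2)) hq0 (by linarith) (by positivity)
    (fun v i j _ => abs_tentGraphon_sub_le (abs_signArray_le v) hd.le _) (fun T => ?_) ?_
  · have h := card_hypercube_lt_le
      (fun v => (n : ℝ) ^ 2 * loss T
        (edgeProb (tentGraphon q d (2 * K : ℕ) (signArray v)) (gridDesign N 1)))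
      (squareLoss N K q d T) (fun v => sum_squareLoss_le (by omega) T v)
      (fun e b => Finset.sum_nonneg fun p _ => sq_nonneg _) (W := W) (by positivity)
      (fun e => by
        have := squareLoss_add_ge (q := q) (d := d) hNn hnN (by omega) T e
        rw [hW]; linarith)
    rw [hcardE] at h
    refine le_trans ?_ h
    refine Nat.cast_le.2 (Finset.card_le_card fun v hv => ?_)
    rw [Finset.mem_filter] at hv ⊢
    refine ⟨hv.1, ?_⟩
    -- The number of squares cancels against their area; `524288 = 16² * 256 * 8`.
    have e : ((K ^ 2 : ℕ) : ℝ) * W / 8 = (n : ℝ) ^ 2 * (d ^ 2 / 524288) := by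
      rw [hW]; push_cast; field_simp; norm_num
    rw [e]
    exact mul_lt_mul_of_pos_left hv.2 (by positivity)
  · have h1 : Real.exp ((n : ℝ) ^ 2 * d ^ 2 / (q * (1 - q))) ≤ (6 / 5 : ℝ) ^ (K ^ 2) := by
      have h2 : Real.exp (1 / 8) ≤ 6 / 5 := by
        by_contra! hcon
        have := pow_lt_pow_left₀ hcon (by norm_num) (n := 8) (by norm_num)
        rw [← Real.exp_nat_mul] at this
        norm_num at this
        linarith [Real.exp_one_lt_d9]
      calc _ ≤ Real.exp ((K ^ 2 : ℕ) * (1 / 8)) := Real.exp_le_exp.2 (by push_cast; linarith)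
        _ = Real.exp (1 / 8) ^ (K ^ 2) := Real.exp_nat_mul _ _
        _ ≤ _ := pow_le_pow_left₀ (Real.exp_pos _).le h2 _
    -- The condition `6 ≤ K` is there because `(9/10)^36 ≤ 1 / 25`.
    have hKK : 36 ≤ K ^ 2 := by nlinarith
    calc _ ≤ (6 / 5 : ℝ) ^ (K ^ 2) * (3 / 4 : ℝ) ^ (K ^ 2) := by gcongr
      _ = (9 / 10 : ℝ) ^ (K ^ 2) := by rw [← mul_pow]; norm_num
      _ ≤ (9 / 10 : ℝ) ^ 36 := pow_le_pow_of_le_one (by norm_num) (by norm_num) hKK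
      _ ≤ _ := by norm_num

/-- The nonparametric rate for `α < 1`, for many nodes. -/
lemma exists_minimaxBound_rough {M α : ℝ} (hM : 0 < M) (hα : 0 < α) (hα1 : α < 1) :
    ∃ c : ℝ, 0 < c ∧ ∀ (n k : ℕ) (l₁ l₂ δ : ℝ), 9216 ≤ n → 1 ≤ k → k ≤ n → 1 ≤ l₂ →
      (latentClass n k l₁ l₂ δ).Nonempty →
      MinimaxBound α M n k l₁ l₂ δ (c * (n : ℝ) ^ (-(2 * α / (α + 1)))) := by
  set q : ℝ := min M 1 / 4 with hq
  have hq0 : 0 < q := by positivity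
  have hqM : 4 * q ≤ M := by have := min_le_left M 1; linarith
  have hq1 : 4 * q ≤ 1 := by have := min_le_right M 1; linarith
  refine ⟨0.8 * ((q / 128) ^ 2 / 524288), by positivity, fun n k l₁ l₂ δ hn hk hkn hl₂ hne => ?_⟩
  have hn1 : (1 : ℝ) ≤ n := by exact_mod_cast (by omega : 1 ≤ n)
  have hn' : (0 : ℝ) < n := by linarith
  -- The balancing resolution, `u * u^α = n`. With `K` of order `u` and `d` of order `u / n =
  -- u^(-α)`, both the Hölder constraint and the information constraint hold up to constants.
  set u : ℝ := (n : ℝ) ^ (1 / (1 + α)) with hu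
  have hu0 : 0 < u := Real.rpow_pos_of_pos hn' _
  have hun : u ≤ n := by
    have := Real.rpow_le_rpow_of_exponent_le hn1 (show 1 / (1 + α) ≤ 1 by
      rw [div_le_one (by linarith)]; linarith)
    rwa [Real.rpow_one] at this
  -- Since `α < 1`, `u ≥ √n ≥ √9216 = 96`, which makes `K = ⌊u / 16⌋` at least `6`.
  have hu96 : 96 ≤ u := by
    have h1 : (n : ℝ) ^ (1 / 2 : ℝ) ≤ u := Real.rpow_le_rpow_of_exponent_le hn1 (by
      rw [div_le_div_iff₀ (by norm_num) (by linarith)]; linarith)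
    rw [← Real.sqrt_eq_rpow] at h1
    refine le_trans (Real.le_sqrt_of_sq_le ?_) h1
    have : (9216 : ℝ) ≤ n := by exact_mod_cast hn
    linarith
  have huα : u * u ^ α = n := by
    rw [hu, ← Real.rpow_mul hn'.le, ← Real.rpow_add hn']
    have : 1 / (1 + α) + 1 / (1 + α) * α = 1 := by field_simp
    rw [this, Real.rpow_one]
  set K := ⌊u / 16⌋₊ with hK
  have hK1 : (K : ℝ) ≤ u / 16 := Nat.floor_le (by positivity)
  have hK2 : u / 16 < K + 1 := Nat.lt_floor_add_one _
  have hK6 : 6 ≤ K := Nat.le_floor (by push_cast; linarith)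
  have hK6' : (6 : ℝ) ≤ K := by exact_mod_cast hK6
  have hKn : 16 * K ≤ n := by
    have : (16 : ℝ) * K ≤ n := by linarith
    exact_mod_cast this
  set d : ℝ := q / 128 * (u / n) with hd
  have hd0 : 0 < d := by positivity
  have hdq : d ≤ q / 128 := mul_le_of_le_one_right (by positivity) ((div_le_one hn').2 hun)
  have hb := minimaxBound_tent (M := M) (δ := δ) hα hα1 hk hkn hl₂ hne hK6 hKn (q := q) (d := d) hq0
    (by linarith) hqM hd0 (by linarith) ?_ ?_
  · refine hb.mono (le_of_eq ?_)
    have : (n : ℝ) ^ (-(2 * α / (α + 1))) = (u / n) ^ 2 := by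
      rw [div_pow, hu, ← Real.rpow_natCast, ← Real.rpow_mul hn'.le, ← Real.rpow_natCast (n : ℝ) 2,
        ← Real.rpow_sub hn']
      congr 1
      push_cast
      field_simp
      ring
    rw [this, hd]
    ring
  · have h1 : ((2 * K : ℕ) : ℝ) ^ α ≤ u ^ α :=
      Real.rpow_le_rpow (by positivity) (by push_cast; linarith) hα.le
    have h2 : d * u ^ α = q / 128 := by
      have : d * u ^ α = q / 128 * (u * u ^ α / n) := by rw [hd]; ring
      rw [this, huα, div_self hn'.ne', mul_one]
    have h3 := mul_le_mul_of_nonneg_left h1 hd0.le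
    linarith
  · rw [div_le_iff₀ (mul_pos hq0 (by linarith))]
    have h1 : (n : ℝ) * d = q / 128 * u := by rw [hd]; field_simp
    have h2 : (n : ℝ) ^ 2 * d ^ 2 = (q / 128) ^ 2 * u ^ 2 := by rw [← mul_pow, h1, mul_pow]
    have h3 : u ^ 2 ≤ (32 * (K : ℝ)) ^ 2 := pow_le_pow_left₀ hu0.le (by linarith) 2
    have h4 : (n : ℝ) ^ 2 * d ^ 2 ≤ (q / 128) ^ 2 * (32 * (K : ℝ)) ^ 2 := by
      rw [h2]; gcongr
    have h5 : (K : ℝ) ^ 2 / 8 * (q * (1 - q)) - (q / 128) ^ 2 * (32 * (K : ℝ)) ^ 2 =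
        (K : ℝ) ^ 2 * q * ((1 - q) / 8 - q / 16) := by ring
    have h6 : 0 ≤ (K : ℝ) ^ 2 * q * ((1 - q) / 8 - q / 16) :=
      mul_nonneg (by positivity) (by linarith)
    linarith


/-! ### Near-orthogonality of cosines and counting of permutations. -/

/-- Telescoping: each term is `sin (c (j + 1/2)) - sin (c (j - 1/2))`. -/
lemma two_mul_sin_mul_sum_cos (c : ℝ) (H : ℕ) :
    2 * Real.sin (c / 2) * ∑ j ∈ Finset.range H, Real.cos (c * j) =
      Real.sin (c * (H - 1 / 2)) + Real.sin (c / 2) := by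
  induction H with
  | zero =>
    have : c * ((0 : ℕ) - 1 / 2) = -(c / 2) := by push_cast; ring
    rw [this, Real.sin_neg]; simp
  | succ H ih =>
    rw [Finset.sum_range_succ, mul_add, ih]
    have e1 : c * ((H + 1 : ℕ) - 1 / 2) = c * H + c / 2 := by push_cast; ring
    have e2 : c * (H - 1 / 2) = c * H - c / 2 := by ring
    rw [e1, e2, Real.sin_add, Real.sin_sub]
    ring

/-- A sum of cosines along an arithmetic progression is at most `π / c`. -/
lemma abs_sum_cos_le {c : ℝ} (hc : 0 < c) (hcπ : c ≤ Real.pi) (H : ℕ) :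
    |∑ j ∈ Finset.range H, Real.cos (c * j)| ≤ Real.pi / c := by
  have hs : c / Real.pi ≤ Real.sin (c / 2) := by
    have := Real.mul_le_sin (x := c / 2) (by linarith) (by linarith)
    calc c / Real.pi = 2 / Real.pi * (c / 2) := by ring
      _ ≤ _ := this
  have hcp : 0 < c / Real.pi := by positivity
  have h := congrArg abs (two_mul_sin_mul_sum_cos c H)
  rw [abs_mul, abs_of_pos (by linarith : 0 < 2 * Real.sin (c / 2))] at h
  have h2 : |Real.sin (c * (H - 1 / 2)) + Real.sin (c / 2)| ≤ 2 := by
    refine (abs_add_le _ _).trans ?_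
    linarith [Real.abs_sin_le_one (c * (H - 1 / 2)), Real.abs_sin_le_one (c / 2)]
  set S := |∑ j ∈ Finset.range H, Real.cos (c * j)|
  have hS : 0 ≤ S := abs_nonneg _
  rw [le_div_iff₀ hc]
  have h3 : c / Real.pi * S ≤ 1 := by nlinarith
  rw [div_mul_eq_mul_div, div_le_one Real.pi_pos] at h3
  linarith

/-- Two cosines with well separated frequencies are nearly orthogonal. -/
lemma sum_sq_cos_sub_cos_ge {a b B : ℝ} (H : ℕ) (hB : 0 < B) (ha : Real.pi / B ≤ 2 * a)
    (hb : Real.pi / B ≤ 2 * b) (hab : Real.pi / B ≤ |a - b|) (ha2 : 2 * a ≤ Real.pi)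
    (hb2 : 2 * b ≤ Real.pi) :
    (H : ℝ) - 3 * B ≤
      ∑ j ∈ Finset.range H, (Real.cos (a * j) - Real.cos (b * j)) ^ 2 := by
  have hπB : 0 < Real.pi / B := div_pos Real.pi_pos hB
  have hS : ∀ c, Real.pi / B ≤ c → c ≤ Real.pi →
      |∑ j ∈ Finset.range H, Real.cos (c * j)| ≤ B := by
    intro c h1 h2
    have hc : 0 < c := hπB.trans_le h1
    refine (abs_sum_cos_le hc h2 H).trans ?_
    rw [div_le_iff₀ hB] at h1
    rw [div_le_iff₀ hc]; linarith
  have s1 := abs_le.1 (hS (2 * a) ha ha2)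
  have s2 := abs_le.1 (hS (2 * b) hb hb2)
  have s3 := abs_le.1 (hS (a + b) (by linarith) (by linarith))
  have s4 := abs_le.1 (hS |a - b| hab (abs_le.2 ⟨by linarith, by linarith⟩))
  -- The square expands into `1` plus cosines of frequencies `2a`, `2b`, `a + b` and `|a - b|`.
  -- Their sums are at most `B` in absolute value and enter with weights `1/2`, `1/2`, `1`, `1`, for
  -- a total error of `3 B`.
  have hpt : ∀ j : ℕ, (Real.cos (a * j) - Real.cos (b * j)) ^ 2 =
      1 + Real.cos (2 * a * j) / 2 + Real.cos (2 * b * j) / 2 - Real.cos ((a + b) * j)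
        - Real.cos (|a - b| * j) := by
    intro j
    have e1 : Real.cos (|a - b| * j) = Real.cos ((a - b) * j) := by
      rcases abs_choice (a - b) with h | h <;> rw [h]
      rw [neg_mul, Real.cos_neg]
    have e2 : 2 * a * (j : ℝ) = 2 * (a * j) := by ring
    have e3 : 2 * b * (j : ℝ) = 2 * (b * j) := by ring
    rw [e1, e2, e3, Real.cos_two_mul, Real.cos_two_mul, add_mul, sub_mul, Real.cos_add,
      Real.cos_sub]
    ring
  simp_rw [hpt]
  rw [Finset.sum_sub_distrib, Finset.sum_sub_distrib, Finset.sum_add_distrib,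
    Finset.sum_add_distrib, ← Finset.sum_div, ← Finset.sum_div]
  simp only [Finset.sum_const, Finset.card_range, nsmul_eq_mul, mul_one]
  linarith

/-- A set of integers with differences less than `w` has at most `w + 1` elements. -/
lemma card_le_of_abs_sub_lt {S : Finset ℕ} {w : ℝ} (hw : 0 ≤ w)
    (h : ∀ s ∈ S, ∀ t ∈ S, |(s : ℝ) - t| < w) : (S.card : ℝ) ≤ w + 1 := by
  rcases S.eq_empty_or_nonempty with rfl | hS
  · simp; linarith
  · have hsub : S ⊆ Finset.Icc (S.min' hS) (S.max' hS) := fun s hs =>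
      Finset.mem_Icc.2 ⟨S.min'_le s hs, S.le_max' s hs⟩
    have h1 := Finset.card_le_card hsub
    rw [Nat.card_Icc] at h1
    have h2 := (abs_lt.1 (h _ (S.max'_mem hS) _ (S.min'_mem hS))).2
    have h3 : S.card + S.min' hS ≤ S.max' hS + 1 := by
      have := S.min'_le_max' hS
      omega
    have h4 : (S.card : ℝ) + (S.min' hS : ℕ) ≤ (S.max' hS : ℕ) + 1 := by exact_mod_cast h3
    linarith

/-- A bound on the permanent of a nonnegative matrix by its row sums. -/
lemma sum_perm_prod_le {ι : Type*} [Fintype ι] [DecidableEq ι] (g : ι → ι → ℝ)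
    (hg : ∀ i j, 0 ≤ g i j) {R : ℝ} (hR : ∀ i, ∑ j, g i j ≤ R) :
    ∑ v : Equiv.Perm ι, ∏ i, g i (v i) ≤ R ^ Fintype.card ι := by
  calc ∑ v : Equiv.Perm ι, ∏ i, g i (v i) ≤ ∑ τ : ι → ι, ∏ i, g i (τ i) := by
        have hinj : Function.Injective (fun v : Equiv.Perm ι => (v : ι → ι)) :=
          fun v τ h => Equiv.ext (congrFun h)
        rw [← Finset.sum_image (s := Finset.univ) (g := fun v : Equiv.Perm ι => (v : ι → ι))
          (f := fun τ : ι → ι => ∏ i, g i (τ i)) (fun v _ τ _ h => hinj h)]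
        exact Finset.sum_le_univ_sum_of_nonneg fun τ => Finset.prod_nonneg fun i _ => hg _ _
    _ = ∏ i, ∑ j, g i j := by
        rw [Finset.prod_univ_sum, Fintype.piFinset_univ]
    _ ≤ ∏ _i : ι, R := Finset.prod_le_prod (fun i _ => Finset.sum_nonneg fun j _ => hg i j)
        fun i _ => hR i
    _ = _ := by rw [Finset.prod_const, Finset.card_univ]

/-- One term of the exponential series. It compares the permanent bound, of order `L ^ L`, with the
number `L!` of permutations. -/
lemma pow_self_le_exp_mul_factorial (L : ℕ) : (L : ℝ) ^ L ≤ Real.exp L * L.factorial := by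
  have := Real.pow_div_factorial_le_exp (x := L) (Nat.cast_nonneg _) L
  rwa [div_le_iff₀ (by exact_mod_cast Nat.factorial_pos L)] at this

/-- An exponential moment bound: if the loss `X v` of a permutation is at least a sum of losses of
the positions of single elements, and few positions have a loss below `W`, then few permutations
have small loss. -/
lemma card_perm_lt_le {ι : Type*} [Fintype ι] [DecidableEq ι] [Nonempty ι]
    (X : Equiv.Perm ι → ℝ) (Y : ι → ι → ℝ)
    (hX : ∀ v, ∑ i, Y i (v i) ≤ X v) (hY : ∀ i j, 0 ≤ Y i j) {W m A : ℝ} (hW : 0 < W) (hm : 1 < m)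
    (hYW : ∀ i, ((Finset.univ.filter fun j => Y i j < W).card : ℝ) ≤ A * Fintype.card ι / m) :
    ((Finset.univ.filter fun v => X v < Fintype.card ι * W / 2).card : ℝ) ≤
      (3 * (A + 1) / m ^ (1 / 2 : ℝ)) ^ Fintype.card ι * Fintype.card (Equiv.Perm ι) := by
  classical
  obtain ⟨L, hL⟩ : ∃ L, L = Fintype.card ι := ⟨_, rfl⟩
  rw [Fintype.card_perm, ← hL]
  rw [← hL] at hYW
  have hL0 : 0 < L := hL ▸ Fintype.card_pos
  have hm0 : 0 < m := by linarith
  -- With `exp (-s W) = 1 / m`, the costly positions of a row contribute at most `L / m` in all,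
  -- comparable to the cheap ones. The threshold `L W / 2` costs only `m ^ (L / 2)`, which leaves a
  -- gain of `√m` per element.
  set s : ℝ := Real.log m / W with hs
  have hs0 : 0 < s := div_pos (Real.log_pos hm) hW
  have hsW : s * W = Real.log m := by rw [hs]; field_simp
  have hA : 0 ≤ A := by
    by_contra! hcon
    have h1 := hYW (Classical.arbitrary ι)
    have h2 : A * L / m < 0 := div_neg_of_neg_of_pos
      (mul_neg_of_neg_of_pos hcon (by exact_mod_cast hL0)) hm0
    have h3 : (0 : ℝ) ≤ (Finset.univ.filter fun j => Y (Classical.arbitrary ι) j < W).card :=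
      Nat.cast_nonneg _
    linarith
  have hrow : ∀ i, ∑ j, Real.exp (-(s * Y i j)) ≤ (A + 1) * L / m := by
    intro i
    have hpt : ∀ j, Real.exp (-(s * Y i j)) ≤ (if Y i j < W then 1 else 0) + 1 / m := by
      intro j
      split_ifs with h
      · have : Real.exp (-(s * Y i j)) ≤ 1 :=
          Real.exp_le_one_iff.2 (by have := hY i j; simp; positivity)
        have : 0 < 1 / m := by positivity
        linarith
      · rw [zero_add, one_div, ← Real.exp_log hm0, ← Real.exp_neg, ← hsW]
        exact Real.exp_le_exp.2 (neg_le_neg (mul_le_mul_of_nonneg_left (not_lt.1 h) hs0.le))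
    refine (Finset.sum_le_sum fun j _ => hpt j).trans ?_
    rw [Finset.sum_add_distrib, Finset.sum_boole, Finset.sum_const, Finset.card_univ, ← hL,
      nsmul_eq_mul]
    have := hYW i
    calc _ ≤ A * L / m + L * (1 / m) := by linarith
      _ = _ := by ring
  have hsq : Real.exp (s * (W / 2)) = m ^ (1 / 2 : ℝ) := by
    rw [Real.rpow_def_of_pos hm0, ← hsW]; congr 1; ring
  generalize hS : (Finset.univ.filter fun v => X v < L * W / 2) = S
  have hmem : ∀ v ∈ S, X v < L * W / 2 := fun v hv => by
    rw [← hS] at hv; exact (Finset.mem_filter.1 hv).2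
  have h1 : (S.card : ℝ) ≤ ∑ v ∈ S,
      Real.exp (s * (L * W / 2)) * ∏ i, Real.exp (-(s * Y i (v i))) := by
    rw [Finset.card_eq_sum_ones, Nat.cast_sum]
    refine Finset.sum_le_sum fun v hv => ?_
    rw [← Real.exp_sum, ← Real.exp_add, Nat.cast_one]
    refine Real.one_le_exp ?_
    rw [Finset.sum_neg_distrib, ← Finset.mul_sum, ← sub_eq_add_neg, ← mul_sub]
    have := hmem v hv
    exact mul_nonneg hs0.le (by linarith [hX v])
  have h2 : ∑ v ∈ S, Real.exp (s * (L * W / 2)) * ∏ i, Real.exp (-(s * Y i (v i))) ≤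
      ∑ v : Equiv.Perm ι, Real.exp (s * (L * W / 2)) * ∏ i, Real.exp (-(s * Y i (v i))) :=
    Finset.sum_le_univ_sum_of_nonneg fun v => by positivity
  have h3 : ∑ v : Equiv.Perm ι, Real.exp (s * (L * W / 2)) * ∏ i, Real.exp (-(s * Y i (v i))) ≤
      (m ^ (1 / 2 : ℝ)) ^ L * ((A + 1) * L / m) ^ L := by
    have e : Real.exp (s * (L * W / 2)) = (m ^ (1 / 2 : ℝ)) ^ L := by
      rw [← hsq, ← Real.exp_nat_mul]; congr 1; ring
    rw [← Finset.mul_sum, e]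
    have := sum_perm_prod_le (fun i j => Real.exp (-(s * Y i j))) (fun i j => (Real.exp_pos _).le)
      hrow
    rw [← hL] at this
    exact mul_le_mul_of_nonneg_left this (by positivity)
  refine h1.trans (h2.trans (h3.trans ?_))
  have hexp : Real.exp L ≤ 3 ^ L := by
    have : Real.exp L = Real.exp 1 ^ L := by rw [← Real.exp_nat_mul, mul_one]
    rw [this]
    exact pow_le_pow_left₀ (Real.exp_pos _).le (by linarith [Real.exp_one_lt_d9]) _
  have hfac : (L : ℝ) ^ L ≤ 3 ^ L * L.factorial :=
    (pow_self_le_exp_mul_factorial L).trans (mul_le_mul_of_nonneg_right hexp (by positivity))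
  have hr0 : 0 < m ^ (1 / 2 : ℝ) := Real.rpow_pos_of_pos hm0 _
  have hmm : m = m ^ (1 / 2 : ℝ) * m ^ (1 / 2 : ℝ) := by
    rw [← Real.rpow_add hm0]; norm_num
  calc (m ^ (1 / 2 : ℝ)) ^ L * ((A + 1) * L / m) ^ L
      = ((A + 1) / m ^ (1 / 2 : ℝ)) ^ L * (L : ℝ) ^ L := by
        rw [← mul_pow, ← mul_pow]
        congr 1
        nth_rewrite 2 [hmm]
        field_simp
    _ ≤ ((A + 1) / m ^ (1 / 2 : ℝ)) ^ L * (3 ^ L * L.factorial) :=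
        mul_le_mul_of_nonneg_left hfac (by positivity)
    _ = _ := by rw [← mul_assoc, ← mul_pow]; congr 2; ring


/-! ### Unknown positions and the clustering rate. -/

lemma sum_comp_le_sum {A B : Type*} [Fintype A] [Fintype B] {e : A → B}
    (he : Function.Injective e) {f : B → ℝ} (hf : ∀ b, 0 ≤ f b) : ∑ a, f (e a) ≤ ∑ b, f b := by
  classical
  rw [← Finset.sum_image (s := Finset.univ) (g := e) (f := f) (fun a _ b _ h => he h)]
  exact Finset.sum_le_univ_sum_of_nonneg hf

/-- The nodes in the upper half of the first `N` nodes. -/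
abbrev UpperNode (n N : ℕ) : Type := {i : Fin n // N / 2 ≤ (i : ℕ) ∧ (i : ℕ) < N}

lemma card_upperNode {n N : ℕ} (hN : N ≤ n) : Fintype.card (UpperNode n N) = N - N / 2 := by
  have e : UpperNode n N ≃ Fin (N - N / 2) :=
    { toFun := fun i => ⟨i.1 - N / 2, by have := i.2; omega⟩
      invFun := fun j => ⟨⟨j + N / 2, by omega⟩, by constructor <;> simp; omega⟩
      left_inv := fun i => by ext; have := i.2; simp; omega
      right_inv := fun j => by ext; simp }
  rw [Fintype.card_congr e, Fintype.card_fin]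

/-- The part of the squared loss of `T` in the row `i` and the columns of the lower nodes, when the
node `i` has the grid position `t`. -/
noncomputable def rowLoss {n N : ℕ} (hN : N ≤ n) (q d c : ℝ) (T : Matrix (Fin n) (Fin n) ℝ)
    (i t : UpperNode n N) : ℝ :=
  ∑ j : Fin (N / 2), (T i (j.castLE ((Nat.div_le_self N 2).trans hN)) -
    (q + d * Real.cos (c / (N : ℝ) ^ 2 * ((t : Fin n) : ℕ) * (j : ℕ)))) ^ 2

/-- Only entries joining an upper node to a lower node are kept. The permutation moves upper nodes
alone, so the column positions are known and row `i` depends on `v` through `v i` only. -/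
lemma sum_rowLoss_le {n N : ℕ} (hn : 1 ≤ n) (hN : N ≤ n) (q d c : ℝ)
    (T : Matrix (Fin n) (Fin n) ℝ) (v : Equiv.Perm (UpperNode n N)) :
    ∑ i, rowLoss hN q d c T i (v i) ≤ (n : ℝ) ^ 2 * loss T
      (edgeProb (cosGraphon q d c) (gridDesign N (Equiv.Perm.ofSubtype v))) := by
  rw [sq_mul_loss hn]
  set e : UpperNode n N × Fin (N / 2) → Fin n × Fin n := fun p =>
    (p.1.1, p.2.castLE ((Nat.div_le_self N 2).trans hN)) with he
  have hinj : Function.Injective e := by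
    rintro ⟨i, j⟩ ⟨i', j'⟩ h
    simp only [he, Prod.mk.injEq, Fin.castLE_inj] at h
    exact Prod.ext (Subtype.ext h.1) h.2
  refine le_trans (le_of_eq ?_) (sum_comp_le_sum hinj fun b => sq_nonneg _)
  rw [Fintype.sum_prod_type]
  refine Finset.sum_congr rfl fun i _ => Finset.sum_congr rfl fun j _ => ?_
  have h1 : Equiv.Perm.ofSubtype v i.1 = (v i : Fin n) := Equiv.Perm.ofSubtype_apply_coe v i
  have h2 : Equiv.Perm.ofSubtype v (j.castLE ((Nat.div_le_self N 2).trans hN)) =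
      j.castLE ((Nat.div_le_self N 2).trans hN) :=
    Equiv.Perm.ofSubtype_apply_of_not_mem v (by simp)
  have hne : (i : Fin n) ≠ j.castLE ((Nat.div_le_self N 2).trans hN) := by
    intro h
    have h3 := congrArg Fin.val h
    have := i.2.1
    simp only [Fin.val_castLE] at h3
    have := j.2
    omega
  have hj : (j : ℕ) < N := by have := j.2; omega
  simp only [he, edgeProb, Matrix.of_apply, hne, if_false, gridDesign, h1, h2, gridPoint,
    (v i).2.2, if_true, Fin.val_castLE, hj, cosGraphon]
  congr 5
  ring

/-- If two positions both fit row `i` of `T`, their cosine rows are close to each other in mean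
square, whereas well separated frequencies give nearly orthogonal rows. -/
lemma rowLoss_separation {n N : ℕ} (hN : N ≤ n) (hN8 : 8 ≤ N) {q d m : ℝ} (hm : 24 ≤ m)
    (hmN : 4 * m ≤ N) (T : Matrix (Fin n) (Fin n) ℝ) (i t s : UpperNode n N)
    (ht : rowLoss hN q d (2 * Real.pi * m) T i t < d ^ 2 * N / 16)
    (hs : rowLoss hN q d (2 * Real.pi * m) T i s < d ^ 2 * N / 16) :
    |(((t : Fin n) : ℕ) : ℝ) - ((s : Fin n) : ℕ)| < 16 * N / m := by
  by_contra! hcon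
  have hN' : (8 : ℝ) ≤ N := by exact_mod_cast hN8
  have hN0 : (0 : ℝ) < N := by linarith
  have hπ := Real.pi_pos
  set ω : ℝ := 2 * Real.pi * m / (N : ℝ) ^ 2 with hω
  have hω0 : 0 < ω := by positivity
  have hhalf : ∀ u : UpperNode n N, (N : ℝ) / 3 ≤ ((u : Fin n) : ℕ) ∧ (((u : Fin n) : ℕ) : ℝ) ≤ N := by
    intro u
    have h1 : N ≤ 3 * ((u : Fin n) : ℕ) := by have := u.2.1; omega
    have h2 : (N : ℝ) ≤ 3 * ((u : Fin n) : ℕ) := by exact_mod_cast h1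
    exact ⟨by linarith, by exact_mod_cast u.2.2.le⟩
  -- Near-orthogonality is applied with `B = N / 32`. Positions above `N / 3` and `m ≥ 24` give the
  -- lower bound on frequencies, `4 m ≤ N` the upper one, and the separation `16 N / m` is exactly
  -- `32 π / N` in frequency.
  have hlow : ∀ u : UpperNode n N, Real.pi / (N / 32) ≤ 2 * (ω * ((u : Fin n) : ℕ)) := by
    intro u
    have := (hhalf u).1
    have e : 2 * (ω * ((u : Fin n) : ℕ)) = Real.pi * (4 * (m * ((u : Fin n) : ℕ))) / (N : ℝ) ^ 2 := by
      rw [hω]; ring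
    have e2 : Real.pi / (N / 32) = Real.pi * (32 * N) / (N : ℝ) ^ 2 := by field_simp
    rw [e, e2]
    gcongr Real.pi * ?_ / _
    nlinarith
  have hup : ∀ u : UpperNode n N, 2 * (ω * ((u : Fin n) : ℕ)) ≤ Real.pi := by
    intro u
    have := (hhalf u).2
    have e : 2 * (ω * ((u : Fin n) : ℕ)) = Real.pi * (4 * m * ((u : Fin n) : ℕ)) / (N : ℝ) ^ 2 := by
      rw [hω]; ring
    rw [e, div_le_iff₀ (by positivity), pow_two]
    gcongr
  have hdiff : Real.pi / (N / 32) ≤ |ω * ((t : Fin n) : ℕ) - ω * ((s : Fin n) : ℕ)| := by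
    rw [← mul_sub, abs_mul, abs_of_pos hω0]
    refine le_trans (le_of_eq ?_) (mul_le_mul_of_nonneg_left hcon hω0.le)
    rw [hω]
    field_simp
    norm_num
  have hsum := sum_sq_cos_sub_cos_ge (N / 2) (by positivity) (hlow t) (hlow s) hdiff (hup t) (hup s)
  have hH : (N : ℝ) - 1 ≤ 2 * (N / 2 : ℕ) := by
    have : N ≤ 2 * (N / 2) + 1 := by omega
    have : (N : ℝ) ≤ 2 * (N / 2 : ℕ) + 1 := by exact_mod_cast this
    linarith
  have hge : (N : ℝ) / 4 ≤ ∑ j ∈ Finset.range (N / 2),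
      (Real.cos (ω * ((t : Fin n) : ℕ) * j) - Real.cos (ω * ((s : Fin n) : ℕ) * j)) ^ 2 := by
    linarith
  have hle : d ^ 2 * ∑ j ∈ Finset.range (N / 2),
      (Real.cos (ω * ((t : Fin n) : ℕ) * j) - Real.cos (ω * ((s : Fin n) : ℕ) * j)) ^ 2 ≤
      2 * rowLoss hN q d (2 * Real.pi * m) T i t + 2 * rowLoss hN q d (2 * Real.pi * m) T i s := by
    rw [Finset.sum_range]
    unfold rowLoss
    rw [Finset.mul_sum, Finset.mul_sum, Finset.mul_sum, ← Finset.sum_add_distrib]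
    refine Finset.sum_le_sum fun j _ => ?_
    rw [← hω]
    nlinarith [sq_nonneg ((T i (j.castLE ((Nat.div_le_self N 2).trans hN)) -
      (q + d * Real.cos (ω * ((t : Fin n) : ℕ) * (j : ℕ)))) +
      (T i (j.castLE ((Nat.div_le_self N 2).trans hN)) -
      (q + d * Real.cos (ω * ((s : Fin n) : ℕ) * (j : ℕ)))))]
  have := mul_le_mul_of_nonneg_left hge (sq_nonneg d)
  linarith

/-- The lower bound from an oscillating graphon with unknown positions of half of the nodes. -/
lemma minimaxBound_cos {α M : ℝ} (hα : 0 < α) {n k : ℕ} {l₁ l₂ δ : ℝ}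
    (hk : 1 ≤ k) (hkn : k ≤ n) (hl₂ : 1 ≤ l₂) (hne : (latentClass n k l₁ l₂ δ).Nonempty)
    {q d m : ℝ} (hm : 2625 ≤ m ^ (1 / 4 : ℝ)) (hm24 : 24 ≤ m) (hmn : 8 * m ≤ n) (hq0 : 0 < q)
    (hq : 2 * q ≤ 1) (hqM : 4 * q ≤ M) (hd : 0 < d) (hdq : d ≤ q)
    (hdM : 4 * (d * ((⌊α⌋₊ + 1).factorial * (max 1 (2 * (2 * Real.pi * m))) ^ (⌊α⌋₊ + 1))) ≤ M)
    (hinfo : (n : ℝ) * d ^ 2 / (q * (1 - q)) ≤ Real.log m / 16) :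
    MinimaxBound α M n k l₁ l₂ δ (0.8 * (d ^ 2 / 256)) := by
  classical
  obtain ⟨N, hNn, hnN, hN⟩ := exists_gridDesign_mem_wellSpread hk hkn hl₂ hne
  have hnN' : (n : ℝ) ≤ 2 * N := by exact_mod_cast hnN.le
  have hm0 : 0 < m := by linarith
  have hN8' : (8 : ℝ) ≤ N := by linarith
  have hN8 : 8 ≤ N := by exact_mod_cast hN8'
  have hn0 : (0 : ℝ) < n := by linarith
  set L := Fintype.card (UpperNode n N) with hL
  have hLN : N ≤ 2 * L := by rw [hL, card_upperNode hNn]; omega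
  have hLN' : (N : ℝ) ≤ 2 * L := by exact_mod_cast hLN
  have hL0 : 0 < L := by omega
  have : Nonempty (UpperNode n N) := Fintype.card_pos_iff.1 hL0
  set W : ℝ := d ^ 2 * N / 16 with hW
  have hW0 : 0 < W := by positivity
  refine minimaxBound_of_family (V := Equiv.Perm (UpperNode n N))
    (fun _ => cosGraphon q d (2 * Real.pi * m)) (fun v => gridDesign N (Equiv.Perm.ofSubtype v))
    (fun _ => cosGraphon_mem hα hd.le (by positivity) hq hqM hdq hdM) (fun v => hN _) (q := q) (d := d)
    (ρ := (3 * (34 + 1) / m ^ (1 / 2 : ℝ)) ^ L) hq0 (by linarith) (by positivity)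
    (fun v i j _ => ?_) (fun T => ?_) ?_
  · rw [cosGraphon, add_sub_cancel_left, abs_mul, abs_of_pos hd]
    exact mul_le_of_le_one_right hd.le (Real.abs_cos_le_one _)
  · have h := card_perm_lt_le
      (fun v => (n : ℝ) ^ 2 * loss T (edgeProb (cosGraphon q d (2 * Real.pi * m))
        (gridDesign N (Equiv.Perm.ofSubtype v))))
      (rowLoss hNn q d (2 * Real.pi * m) T)
      (fun v => sum_rowLoss_le (by exact_mod_cast (by linarith : (1 : ℝ) ≤ n)) hNn q d _ T v)
      (fun i t => Finset.sum_nonneg fun j _ => sq_nonneg _) (W := W) (m := m) (A := 34) hW0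
      (by linarith) (fun i => ?_)
    · rw [← hL] at h
      refine le_trans ?_ h
      refine Nat.cast_le.2 (Finset.card_le_card fun v hv => ?_)
      rw [Finset.mem_filter] at hv ⊢
      refine ⟨hv.1, (mul_lt_mul_of_pos_left hv.2 (by positivity)).trans_le ?_⟩
      have h1 : (n : ℝ) ^ 2 ≤ (2 * N) ^ 2 := pow_le_pow_left₀ hn0.le hnN' 2
      calc (n : ℝ) ^ 2 * (d ^ 2 / 256) ≤ (2 * N) ^ 2 * (d ^ 2 / 256) := by gcongr
        _ = N * (d ^ 2 * N / 64) := by ring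
        _ ≤ (2 * L) * (d ^ 2 * N / 64) := by gcongr
        _ = _ := by rw [hW]; ring
    · have hinj : Function.Injective fun t : UpperNode n N => ((t : Fin n) : ℕ) :=
        fun s t h => Subtype.ext (Fin.ext h)
      have h1 := card_le_of_abs_sub_lt (S := (Finset.univ.filter fun t =>
          rowLoss hNn q d (2 * Real.pi * m) T i t < W).image fun t : UpperNode n N => ((t : Fin n) : ℕ))
        (w := 16 * N / m) (by positivity) (by
          intro s hs t ht
          obtain ⟨s, hs', rfl⟩ := Finset.mem_image.1 hs
          obtain ⟨t, ht', rfl⟩ := Finset.mem_image.1 ht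
          exact rowLoss_separation hNn hN8 hm24 (by linarith) T i s t
            (Finset.mem_filter.1 hs').2 (Finset.mem_filter.1 ht').2)
      rw [Finset.card_image_of_injective _ hinj] at h1
      -- `A = 34` suffices: `16 N ≤ 32 L`, and the additional one is absorbed by `m ≤ N / 4 ≤ 2 L`.
      refine h1.trans ?_
      rw [← hL, div_add_one hm0.ne']
      gcongr
      linarith
  · set u := m ^ (1 / 4 : ℝ) with hu
    have hu0 : 0 < u := Real.rpow_pos_of_pos hm0 _
    have hmu : m ^ (1 / 2 : ℝ) = u * u := by
      rw [hu, ← Real.rpow_add hm0]; norm_num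
    have h1 : Real.exp ((n : ℝ) ^ 2 * d ^ 2 / (q * (1 - q))) ≤ u ^ L := by
      have e : u ^ L = Real.exp (L * (Real.log m / 4)) := by
        rw [hu, Real.rpow_def_of_pos hm0, ← Real.exp_nat_mul]; congr 1; ring
      rw [e]
      refine Real.exp_le_exp.2 ?_
      have e2 : (n : ℝ) ^ 2 * d ^ 2 / (q * (1 - q)) = n * (n * d ^ 2 / (q * (1 - q))) := by ring
      have hlog : 0 ≤ Real.log m := Real.log_nonneg (by linarith)
      rw [e2]
      calc _ ≤ n * (Real.log m / 16) := mul_le_mul_of_nonneg_left hinfo hn0.le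
        _ ≤ (4 * L) * (Real.log m / 16) := by gcongr; linarith
        _ = _ := by ring
    -- The second moment uses up half of the gain `√m = u * u` per node. What remains is `105 / u ≤
    -- 1 / 25`, that is, `u ≥ 2625`.
    calc _ ≤ u ^ L * (3 * (34 + 1) / m ^ (1 / 2 : ℝ)) ^ L := by gcongr
      _ = (105 / u) ^ L := by
        rw [← mul_pow, hmu]; congr 1; field_simp; norm_num
      _ ≤ (1 / 25) ^ L := by
        refine pow_le_pow_left₀ (by positivity) ?_ _
        rw [div_le_div_iff₀ hu0 (by norm_num)]; linarith
      _ ≤ (1 / 25) ^ 1 := pow_le_pow_of_le_one (by norm_num) (by norm_num) hL0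
      _ = _ := by norm_num

/-- The clustering rate, for many nodes. -/
lemma exists_minimaxBound_log {M α : ℝ} (hM : 0 < M) (hα : 0 < α) :
    ∃ c : ℝ, 0 < c ∧ ∃ n₀ : ℕ, ∀ (n k : ℕ) (l₁ l₂ δ : ℝ), n₀ ≤ n → 1 ≤ k → k ≤ n → 1 ≤ l₂ →
      (latentClass n k l₁ l₂ δ).Nonempty →
      MinimaxBound α M n k l₁ l₂ δ (c * (Real.log n / n)) := by
  set q : ℝ := min M 1 / 4 with hq
  have hq0 : 0 < q := by positivity
  have hqM : 4 * q ≤ M := by have := min_le_left M 1; linarith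
  have hq1 : 4 * q ≤ 1 := by have := min_le_right M 1; linarith
  set l := ⌊α⌋₊ with hl
  -- Chosen so that `m ^ (l + 1) = n ^ (1/4)`: the top derivative of the cosine then grows like `n ^
  -- (1/4)`, which an amplitude of order `√(log n / n)` compensates.
  set ε : ℝ := 1 / (4 * (l + 1)) with hε
  have hε0 : 0 < ε := by positivity
  have hε1 : ε ≤ 1 / 4 := by
    rw [hε]
    have : (0 : ℝ) ≤ l := Nat.cast_nonneg _
    gcongr; linarith
  -- Constant of the derivative bound apart from `m ^ (l + 1)`; here `4 π < 13`.
  set X : ℝ := ((l + 1).factorial : ℕ) * 13 ^ (l + 1) with hX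
  have hX1 : 1 ≤ X := by
    have h1 : (1 : ℝ) ≤ ((l + 1).factorial : ℕ) := by exact_mod_cast Nat.factorial_pos _
    have h2 : (1 : ℝ) ≤ 13 ^ (l + 1) := one_le_pow₀ (by norm_num)
    exact one_le_mul_of_one_le_of_one_le h1 h2
  set c₀ : ℝ := q * ε / (32 * X) with hc₀
  have hc0 : 0 < c₀ := by positivity
  have hcX : c₀ * X = q * ε / 32 := by rw [hc₀]; field_simp
  have hcq : c₀ ≤ q * ε / 32 := (le_mul_of_one_le_right hc0.le hX1).trans_eq hcX
  -- The exponent is `ε / 4`, so `n ≥ B` gives `m ^ (1/4) ≥ 2625`.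
  obtain ⟨B, hB⟩ : ∃ B : ℝ, B ^ (1 / (16 * ((l : ℝ) + 1))) = 2625 ∧ 0 ≤ B :=
    ⟨2625 ^ (16 * ((l : ℝ) + 1)), by
      rw [← Real.rpow_mul (by norm_num), mul_one_div_cancel (by positivity), Real.rpow_one],
      by positivity⟩
  obtain ⟨n₀, hn₀⟩ := exists_nat_ge (max 16 B)
  refine ⟨0.8 * (c₀ ^ 2 / 256), by positivity, n₀, fun n k l₁ l₂ δ hn hk hkn hl₂ hne => ?_⟩
  have hn' : max 16 B ≤ n := hn₀.trans (by exact_mod_cast hn)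
  have hn16 : (16 : ℝ) ≤ n := (le_max_left _ _).trans hn'
  have hnB : B ≤ n := (le_max_right _ _).trans hn'
  have hn0 : (0 : ℝ) < n := by linarith
  have hn1 : (1 : ℝ) ≤ n := by linarith
  set m : ℝ := (n : ℝ) ^ ε with hm
  have hm0 : 0 < m := Real.rpow_pos_of_pos hn0 _
  have hm1 : 1 ≤ m := Real.one_le_rpow hn1 hε0.le
  have hroot : 2625 ≤ m ^ (1 / 4 : ℝ) := by
    rw [hm, ← Real.rpow_mul hn0.le]
    refine le_trans (le_of_eq ?_) (Real.rpow_le_rpow hB.2 hnB (by positivity))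
    rw [← hB.1, hε]
    congr 1
    field_simp
    norm_num
  have hmroot : m ^ (1 / 4 : ℝ) ≤ m := by
    simpa using Real.rpow_le_rpow_of_exponent_le hm1 (show (1 / 4 : ℝ) ≤ 1 by norm_num)
  have hm4 : m ≤ (n : ℝ) ^ (1 / 4 : ℝ) := Real.rpow_le_rpow_of_exponent_le hn1 hε1
  set w : ℝ := (n : ℝ) ^ (1 / 4 : ℝ) with hw
  have hw0 : 0 < w := Real.rpow_pos_of_pos hn0 _
  have hw4 : w ^ 4 = n := by
    rw [hw, ← Real.rpow_natCast, ← Real.rpow_mul hn0.le]; norm_num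
  have hw2 : 2 ≤ w := by linarith
  have hlogn : 0 < Real.log n := Real.log_pos (by linarith)
  have hlog : Real.log n ≤ 2 * w ^ 2 := by
    have h1 := Real.log_le_rpow_div hn0.le (show (0 : ℝ) < 1 / 2 by norm_num)
    have h2 : (n : ℝ) ^ (1 / 2 : ℝ) = w ^ 2 := by
      rw [hw, ← Real.rpow_natCast, ← Real.rpow_mul hn0.le]; norm_num
    rw [h2] at h1; linarith
  set d : ℝ := c₀ * Real.sqrt (Real.log n / n) with hd
  have hd0 : 0 < d := by positivity
  have hd2 : d ^ 2 = c₀ ^ 2 * (Real.log n / n) := by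
    rw [hd, mul_pow, Real.sq_sqrt (by positivity)]
  have hdw : d * w ≤ 2 * c₀ := by
    refine abs_le_of_sq_le_sq' ?_ (by positivity) |>.2
    have : d ^ 2 * w ^ 2 = c₀ ^ 2 * (Real.log n * w ^ 2 / w ^ 4) := by
      rw [hd2, ← hw4]; ring
    rw [mul_pow, this, mul_pow]
    have h3 : Real.log n * w ^ 2 / w ^ 4 ≤ 2 := by
      rw [div_le_iff₀ (by positivity)]
      calc _ ≤ 2 * w ^ 2 * w ^ 2 := by gcongr
        _ = _ := by ring
    have h4 := mul_le_mul_of_nonneg_left h3 (sq_nonneg c₀)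
    linarith [sq_nonneg c₀]
  have hdc : d ≤ c₀ := by
    have := mul_le_mul_of_nonneg_left hw2 hd0.le
    linarith
  have hqε : q * ε ≤ q := mul_le_of_le_one_right hq0.le (by linarith)
  have hcq' : c₀ ≤ q := by linarith
  have hb := minimaxBound_cos (M := M) (δ := δ) hα hk hkn hl₂ hne hroot (by linarith) ?_ hq0
    (by linarith) hqM hd0 (hdc.trans hcq') ?_ ?_
  · refine hb.mono (le_of_eq ?_)
    rw [hd2]; ring
  · have h3 : (2 : ℝ) ^ 3 ≤ w ^ 3 := pow_le_pow_left₀ (by norm_num) hw2 3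
    have : 8 * w ≤ w ^ 4 := by
      calc 8 * w = 2 ^ 3 * w := by norm_num
        _ ≤ w ^ 3 * w := by gcongr
        _ = _ := by ring
    linarith
  · have hπ : 2 * (2 * Real.pi * m) ≤ 13 * m := by
      have := mul_le_mul_of_nonneg_right Real.pi_lt_d2.le hm0.le
      linarith
    have h1 : max 1 (2 * (2 * Real.pi * m)) ≤ 13 * m := max_le (by linarith) hπ
    have h2 : m ^ (l + 1) = w := by
      rw [hm, hw, ← Real.rpow_natCast, ← Real.rpow_mul hn0.le]
      congr 1
      rw [hε]; push_cast; field_simp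
    have h3 : (max 1 (2 * (2 * Real.pi * m))) ^ (l + 1) ≤ 13 ^ (l + 1) * w := by
      rw [← h2, ← mul_pow]
      exact pow_le_pow_left₀ (by positivity) h1 _
    have h4 : d * (((l + 1).factorial : ℕ) * (max 1 (2 * (2 * Real.pi * m))) ^ (l + 1)) ≤
        d * (((l + 1).factorial : ℕ) * (13 ^ (l + 1) * w)) := by gcongr
    have h5 : d * (((l + 1).factorial : ℕ) * (13 ^ (l + 1) * w)) = d * w * X := by rw [hX]; ring
    have h6 : d * w * X ≤ 2 * c₀ * X := by gcongr
    linarith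
  · rw [hd2, div_le_iff₀ (mul_pos hq0 (by linarith)), hm, Real.log_rpow hn0]
    have e1 : (n : ℝ) * (c₀ ^ 2 * (Real.log n / n)) = c₀ ^ 2 * Real.log n := by field_simp
    have h1 : c₀ ^ 2 ≤ (q * ε / 32) ^ 2 := pow_le_pow_left₀ hc0.le hcq 2
    have h2 : (q * ε / 32) ^ 2 ≤ ε / 16 * (q * (1 - q)) := by
      have : (q * ε / 32) ^ 2 = ε * q * (q * ε / 1024) := by ring
      have h3 : q * ε ≤ 1 := by linarith
      have h4 : 0 < ε * q := by positivity
      have h5 : q * ε / 1024 ≤ (1 - q) / 16 := by linarith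
      calc _ = ε * q * (q * ε / 1024) := this
        _ ≤ ε * q * ((1 - q) / 16) := mul_le_mul_of_nonneg_left h5 h4.le
        _ = _ := by ring
    rw [e1]
    have := mul_le_mul_of_nonneg_right (h1.trans h2) hlogn.le
    linarith


/-! ### The dominant term of the rate and the conclusion. -/

/-- From `log n ≤ n ^ η / η` with `η = (1 - α) / (1 + α) > 0`, the gap between the exponent `2α / (α
+ 1)` and `1`. -/
lemma rate_le_of_lt_one {α : ℝ} (hα : 0 < α) (hα1 : α < 1) {n : ℕ} (hn : 2 ≤ n) :
    rate α n ≤ (1 + (1 + α) / (1 - α)) * (n : ℝ) ^ (-(2 * α / (α + 1))) := by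
  have hn0 : (0 : ℝ) < n := by exact_mod_cast (by omega : 0 < n)
  have h1 : 0 < (1 - α) / (1 + α) := div_pos (by linarith) (by linarith)
  have h2 := Real.log_le_rpow_div hn0.le h1
  have h3 : (n : ℝ) ^ ((1 - α) / (1 + α)) / ((1 - α) / (1 + α)) / n =
      (1 + α) / (1 - α) * (n : ℝ) ^ (-(2 * α / (α + 1))) := by
    have e : -(2 * α / (α + 1)) = (1 - α) / (1 + α) - 1 := by field_simp; ring
    rw [e, Real.rpow_sub_one hn0.ne']
    have : 1 - α ≠ 0 := by linarith
    field_simp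
  have h4 : Real.log n / n ≤ (1 + α) / (1 - α) * (n : ℝ) ^ (-(2 * α / (α + 1))) := by
    rw [← h3]; gcongr
  unfold rate
  linarith

lemma rate_le_of_one_le {α : ℝ} (hα1 : 1 ≤ α) {n : ℕ} (hn : 2 ≤ n) :
    rate α n ≤ (1 + 1 / Real.log 2) * (Real.log n / n) := by
  have hn2 : (2 : ℝ) ≤ n := by exact_mod_cast hn
  have hn0 : (0 : ℝ) < n := by linarith
  have h1 : (n : ℝ) ^ (-(2 * α / (α + 1))) ≤ (n : ℝ) ^ (-1 : ℝ) := by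
    refine Real.rpow_le_rpow_of_exponent_le (by linarith) (neg_le_neg ?_)
    rw [le_div_iff₀ (by linarith)]; linarith
  rw [Real.rpow_neg_one] at h1
  have hl2 : 0 < Real.log 2 := Real.log_pos (by norm_num)
  have hl : Real.log 2 ≤ Real.log n := Real.log_le_log (by norm_num) hn2
  have h2 : (n : ℝ)⁻¹ ≤ 1 / Real.log 2 * (Real.log n / n) := by
    have e : 1 / Real.log 2 * (Real.log n / n) = Real.log n / Real.log 2 * (n : ℝ)⁻¹ := by ring
    rw [e]
    exact le_mul_of_one_le_left (by positivity) ((one_le_div hl2).2 hl)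
  unfold rate
  linarith

lemma rate_le_two {α : ℝ} (hα : 0 < α) {n : ℕ} (hn : 2 ≤ n) : rate α n ≤ 2 := by
  have hn2 : (2 : ℝ) ≤ n := by exact_mod_cast hn
  have hn0 : (0 : ℝ) < n := by linarith
  have h1 : (n : ℝ) ^ (-(2 * α / (α + 1))) ≤ 1 :=
    Real.rpow_le_one_of_one_le_of_nonpos (by linarith) (neg_nonpos.2 (by positivity))
  have h2 : Real.log n / n ≤ 1 := by
    rw [div_le_one hn0]
    linarith [Real.log_le_sub_one_of_pos hn0]
  unfold rate
  linarith

/-- A lower bound for many nodes at a sequence comparable to the rate gives one for all `n ≥ 2`. -/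
lemma exists_minimaxBound_rate {M α : ℝ} (hM : 0 < M) (hα : 0 < α) {s : ℕ → ℝ} {D : ℝ} (hD : 0 < D)
    (hs : ∀ n, 2 ≤ n → rate α n ≤ D * s n) {c : ℝ} (hc : 0 < c) {n₀ : ℕ}
    (h : ∀ (n k : ℕ) (l₁ l₂ δ : ℝ), n₀ ≤ n → 1 ≤ k → k ≤ n → 1 ≤ l₂ →
      (latentClass n k l₁ l₂ δ).Nonempty → MinimaxBound α M n k l₁ l₂ δ (c * s n)) :
    ∃ C : ℝ, 0 < C ∧ ∀ (n k : ℕ) (l₁ l₂ δ : ℝ), 2 ≤ n → 1 ≤ k → k ≤ n → 1 ≤ l₂ →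
      (latentClass n k l₁ l₂ δ).Nonempty → MinimaxBound α M n k l₁ l₂ δ (C * rate α n) := by
  obtain ⟨r, hr, hsmall⟩ := exists_minimaxBound_of_le hM hα (n₀ := n₀ + 1) (by omega)
  -- The halved `r` absorbs the crude bound `rate α n ≤ 2` used for small `n`.
  refine ⟨min (c / D) (r / 2), by positivity, fun n k l₁ l₂ δ hn hk hkn hl₂ hne => ?_⟩
  have hrate : 0 ≤ rate α n := by
    unfold rate
    have := Real.log_natCast_nonneg n
    positivity
  rcases le_total n n₀ with hnn | hnn
  · refine (hsmall n k l₁ l₂ δ hn (by omega) hk hkn hl₂ hne).mono ?_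
    calc _ ≤ r / 2 * 2 := mul_le_mul (min_le_right _ _) (rate_le_two hα hn) hrate (by positivity)
      _ = r := by ring
  · refine (h n k l₁ l₂ δ hnn hk hkn hl₂ hne).mono ?_
    calc _ ≤ c / D * (D * s n) := mul_le_mul (min_le_left _ _) (hs n hn) hrate (by positivity)
      _ = c * s n := by field_simp

end Graphon

theorem theorem2p4 (M α : ℝ) (hM : 0 < M) (hα : 0 < α) :
    ∃ C : ℝ, 0 < C ∧
      ∀ (n k : ℕ) (l₁ l₂ δ : ℝ), 2 ≤ n → 1 ≤ k → k ≤ n →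
        0 < l₁ → l₁ ≤ 1 → 1 ≤ l₂ → 0 < δ → δ < 1 →
        (Graphon.latentClass n k l₁ l₂ δ).Nonempty →
        (ENNReal.ofReal 0.8 ≤
          ⨅ T : Graphon.Estimator n, ⨆ f ∈ Graphon.graphonClass α M,
            ⨆ μ ∈ Graphon.latentClass n k l₁ l₂ δ,
              Graphon.jointLaw f μ
                {ω | C * Graphon.rate α n ≤ Graphon.loss (T ω.2) (Graphon.edgeProb f ω.1)}) ∧
        (ENNReal.ofReal (C * Graphon.rate α n) ≤
          ⨅ T : Graphon.Estimator n, ⨆ f ∈ Graphon.graphonClass α M,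
            ⨆ μ ∈ Graphon.latentClass n k l₁ l₂ δ,
              ∫⁻ ω, ENNReal.ofReal (Graphon.loss (T ω.2) (Graphon.edgeProb f ω.1))
                ∂(Graphon.jointLaw f μ)) := by
  have key : ∃ C : ℝ, 0 < C ∧ ∀ (n k : ℕ) (l₁ l₂ δ : ℝ), 2 ≤ n → 1 ≤ k → k ≤ n → 1 ≤ l₂ →
      (Graphon.latentClass n k l₁ l₂ δ).Nonempty →
      Graphon.MinimaxBound α M n k l₁ l₂ δ (C * Graphon.rate α n) := by
    rcases lt_or_ge α 1 with hα1 | hα1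
    · obtain ⟨c, hc, h⟩ := Graphon.exists_minimaxBound_rough hM hα hα1
      have : 0 < 1 - α := by linarith
      exact Graphon.exists_minimaxBound_rate hM hα (by positivity)
        (fun n hn => Graphon.rate_le_of_lt_one hα hα1 hn) hc h
    · obtain ⟨c, hc, n₀, h⟩ := Graphon.exists_minimaxBound_log hM hα
      have : 0 < Real.log 2 := Real.log_pos (by norm_num)
      exact Graphon.exists_minimaxBound_rate hM hα (s := fun n => Real.log n / n) (by positivity)
        (fun n hn => Graphon.rate_le_of_one_le hα1 hn) hc h
  obtain ⟨C, hC, h⟩ := key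
  exact ⟨C, hC, fun n k l₁ l₂ δ hn hk hkn _ _ hl₂ _ _ hne => h n k l₁ l₂ δ hn hk hkn hl₂ hne⟩
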